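/- For integers $r,k$ with $r\ge 1$, $k\ge 0$, and a graph $G$ on the vertex set $[n]=\{1,\dots,n\}$, put, for $K\subseteq[n]$ with $|K|\le 2r$, $$\deg_G(K)=\bigl|\{S\subseteq[n] : K\subseteq S,\ |S|=2r,\ S \text{ is a clique in } G\}\bigr|,$$ and let $M_G=M_{G,r,k}$ be the real matrix whose rows and columns are indexed by the $r$-element subsets of $[n]$, with entries $$M_G(I,J)=\deg_G(I\cup J)\cdot\frac{\binom{k}{|I\cup J|}}{\binom{2r}{|I\cup J|}} .$$ Let $G(n,1/2)$ be the random graph on $[n]$ in which each edge is present independently with probability $1/2$. **Theorem.** There is an absolute constant $c>0$ such that for every $\varepsilon>0$ there is an $N$ such that for all $n\ge N$ and all $r\ge 1$, with probability at least $1-\varepsilon$ over $G\leftarrow G(n,1/2)$, the matrix $M_{G,r,k}$ is positive semidefinite for every integer $k\ge 0$ with $$k\le 2^{-cr}\left(\frac{\sqrt n}{\log n}\right)^{1/r}.$$ -/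

import Mathlib

noncomputable section

/-- The edge probability `1/2`. -/
def halfProb : unitInterval := ⟨1 / 2, by norm_num, by norm_num⟩

/-- The distribution `G(n, 1/2)` of Erdős–Rényi random graphs on the vertex set `Fin n`. -/
def randomGraphHalf (n : ℕ) : MeasureTheory.Measure (SimpleGraph (Fin n)) :=
  SimpleGraph.binomialRandom (Fin n) halfProb

/-- `deg_G(I)` at level `r`: the number of vertex sets `S ⊇ I` of size `2r` that are cliques
of `G`. -/
def cliqueDeg {n : ℕ} (G : SimpleGraph (Fin n)) (r : ℕ) (I : Finset (Fin n)) : ℕ :=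
  {S : Finset (Fin n) | I ⊆ S ∧ S.card = 2 * r ∧ G.IsClique (S : Set (Fin n))}.ncard

/-- The matrix `M_G`, indexed by the `r`-subsets of the vertex set, with entries
`deg_G(I ∪ J) * C(k, |I ∪ J|) / C(2r, |I ∪ J|)`. -/
def cliqueMatrix {n : ℕ} (G : SimpleGraph (Fin n)) (r k : ℕ) :
    Matrix {I : Finset (Fin n) // I.card = r} {I : Finset (Fin n) // I.card = r} ℝ :=
  fun I J =>
    (cliqueDeg G r (I.1 ∪ J.1) : ℝ) *
      ((k.choose (I.1 ∪ J.1).card : ℝ) / ((2 * r).choose (I.1 ∪ J.1).card : ℝ))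

end

/-!
The matrix is compared with its deterministic expected value. Rows and columns of `cliqueMatrix` that
do not belong to cliques vanish, and on cliques the entry at `(I, J)` only involves the edges that lie
neither inside `I` nor inside `J` (`cliqueDeg_union`). Up to zero rows and columns, the matrix is
therefore a principal block of the one that ignores the inner edges altogether, and it suffices that
the quadratic form of the latter is nonnegative (`cliqueForm_nonneg`).

Replacing all edge indicators by `1/2` and all counts of extensions by their leading terms leaves an
entry `mainEntry` that depends only on `j = #(I ∩ J)`. It grows by a factor of order `n / k` as `j`
increases by one. Expanding it in the kernels `(#(I ∩ J)).choose i`, which are sums of squares, shows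
that its smallest eigenvalue is at least `2 ^ (-O(r ^ 2)) * k ^ r * n ^ r` (`le_sum_mul_of_growth`,
`le_mainEntry_self`).

Two errors remain. In the first, the indicators of the pairs between `I \ J` and `J \ I` are replaced
by `1/2` one at a time. When all vertices except the two ends of the current pair are fixed, the form
becomes a bilinear form of the `±1` adjacency matrix, so that its norm is at most `n ^ (r - 1)` times
the operator norm of that matrix (`abs_sum_tuple_edge_le`, `abs_sum_card_inter_eq_le`). In the second,
the number of cliques completely joined to `I ∪ J` deviates from its leading term; this is bounded
entrywise from the sizes of common neighbourhoods (`abs_card_cliqueExtensions_sub_le`) and a Schur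
test. Both are at most `2 ^ O(r ^ 2) * k ^ (2 * r) * n ^ (r - 1) * L` with `L` of order `√n * log n`,
which is below the smallest eigenvalue in the stated range of `k`.

The two pseudorandom properties hold with high probability by Hoeffding's inequality and union bounds
(`randomGraphHalf_pseudorandom`). The operator norm is bounded by splitting vectors into binary digits,
which reduces it to sums over pairs of vertex sets at the cost of one logarithm
(`bilinBound_of_discrepancy`). If `k < r` the matrix is zero, and otherwise the range of `k` forces
`r ^ 2` to be at most of order `log n`, which keeps the union bound over sets of fewer than `2 * r`
vertices affordable.
-/

open Finset MeasureTheory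

/-! ### Forms in the intersection size -/

/-- If `f` grows by a factor of at least `2 ^ (r + 1)` at every step, each difference loses at most half
of its leading term, so that the iterated differences up to order `r` are nonnegative. -/
theorem fwdDiff_iter_bounds {f : ℕ → ℝ} {r : ℕ} (hpos : ∀ j, 0 ≤ f j)
    (hgrow : ∀ j < r, 2 ^ (r + 1) * f j ≤ f (j + 1)) (i : ℕ) :
    ∀ j, i + j ≤ r → (1 / 2) ^ i * f (i + j) ≤ (fwdDiff 1)^[i] f j ∧ (fwdDiff 1)^[i] f j ≤ f (i + j) := by
  induction i with
  | zero => intro j _; simp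
  | succ i ih =>
    intro j hj
    rw [Function.iterate_succ_apply', fwdDiff]
    have h1 := ih (j + 1) (by omega)
    have h0 := ih j (by omega)
    have hg := hgrow (i + j) (by omega)
    have e : i + (j + 1) = i + 1 + j := by ring
    have e' : i + j + 1 = i + 1 + j := by ring
    rw [e] at h1
    rw [e'] at hg
    have hp := hpos (i + j)
    have hp1 := hpos (i + 1 + j)
    have hlow : 0 ≤ (fwdDiff 1)^[i] f j := le_trans (by positivity) h0.1
    refine ⟨?_, by linarith [h1.2]⟩
    -- the subtracted term is at most half of the lower bound for the leading one
    have hsmall : f (i + j) ≤ (1 / 2) ^ (i + 1) * f (i + 1 + j) := by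
      have h2 : (2 : ℝ) ^ (i + 1) ≤ 2 ^ (r + 1) := pow_le_pow_right₀ (by norm_num) (by omega)
      have h3 : 2 ^ (i + 1) * f (i + j) ≤ f (i + 1 + j) :=
        le_trans (mul_le_mul_of_nonneg_right h2 hp) hg
      rw [one_div, inv_pow, inv_mul_eq_div, le_div_iff₀ (by positivity)]
      linarith
    have : (1 / 2 : ℝ) ^ i * f (i + 1 + j) = 2 * ((1 / 2) ^ (i + 1) * f (i + 1 + j)) := by
      rw [pow_succ]; ring
    linarith [h1.1, h0.2]

section InterForms

variable {V : Type*} [Fintype V] [DecidableEq V]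

/-- The kernel `(#(I ∩ J)).choose i` counts the `i`-sets inside both `I` and `J`; it is therefore a
sum of squares. -/
theorem sum_choose_inter_eq_sum_sq (r i : ℕ) (x : Finset V → ℝ) :
    ∑ I ∈ powersetCard r univ, ∑ J ∈ powersetCard r univ, x I * x J * ((#(I ∩ J)).choose i : ℝ) =
      ∑ K ∈ powersetCard i (univ : Finset V),
        (∑ I ∈ powersetCard r univ with K ⊆ I, x I) ^ 2 := by
  have h : ∀ I J : Finset V, ((#(I ∩ J)).choose i : ℝ) =
      ∑ K ∈ powersetCard i (univ : Finset V), if K ⊆ I then (if K ⊆ J then 1 else 0) else 0 := by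
    intro I J
    rw [← card_powersetCard, card_eq_sum_ones, Nat.cast_sum]
    simp_rw [← ite_and]
    rw [← sum_filter]
    refine sum_congr ?_ (by simp)
    ext K
    simp [mem_powersetCard, subset_inter_iff, and_comm]
  simp_rw [h, sq, sum_mul_sum, mul_sum, sum_filter]
  rw [sum_congr rfl fun I _ => sum_comm, sum_comm]
  refine sum_congr rfl fun K _ => sum_congr rfl fun I _ => ?_
  split_ifs
  · refine sum_congr rfl fun J _ => ?_
    split_ifs <;> simp
  · simp

/-- A kernel `f #(I ∩ J)` with rapidly growing `f` is positive definite: by Newton's forward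
difference formula it is a nonnegative combination of the kernels `(#(I ∩ J)).choose i`, and the one
for `i = r` is the identity. -/
theorem le_sum_mul_of_growth {f : ℕ → ℝ} {r : ℕ} (hpos : ∀ j, 0 ≤ f j)
    (hgrow : ∀ j < r, 2 ^ (r + 1) * f j ≤ f (j + 1)) (x : Finset V → ℝ) :
    (1 / 2) ^ r * f r * ∑ I ∈ powersetCard r (univ : Finset V), x I ^ 2 ≤
      ∑ I ∈ powersetCard r (univ : Finset V), ∑ J ∈ powersetCard r (univ : Finset V),
        x I * x J * f #(I ∩ J) := by
  have hb := fwdDiff_iter_bounds hpos hgrow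
  have hN : ∀ t ≤ r, f t = ∑ i ∈ range (r + 1), (t.choose i : ℝ) * (fwdDiff 1)^[i] f 0 := by
    intro t ht
    have := shift_eq_sum_fwdDiff_iter 1 f t 0
    simp only [smul_eq_mul, mul_one, zero_add, nsmul_eq_mul] at this
    rw [this]
    refine sum_subset (range_subset_range.2 (by omega)) fun i _ hi => ?_
    rw [Nat.choose_eq_zero_of_lt (by simpa using hi)]
    simp
  have key : ∑ I ∈ powersetCard r (univ : Finset V), ∑ J ∈ powersetCard r (univ : Finset V),
        x I * x J * f #(I ∩ J) = ∑ i ∈ range (r + 1), (fwdDiff 1)^[i] f 0 *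
        ∑ K ∈ powersetCard i (univ : Finset V),
          (∑ I ∈ powersetCard r univ with K ⊆ I, x I) ^ 2 := by
    simp_rw [← sum_choose_inter_eq_sum_sq, mul_sum]
    symm
    rw [sum_comm]
    refine sum_congr rfl fun I hI => ?_
    rw [sum_comm]
    refine sum_congr rfl fun J hJ => ?_
    rw [hN _ ((card_le_card inter_subset_left).trans (mem_powersetCard.1 hI).2.le), mul_sum]
    exact sum_congr rfl fun i _ => by ring
  rw [key, sum_range_succ]
  have hrest : 0 ≤ ∑ i ∈ range r, (fwdDiff 1)^[i] f 0 * ∑ K ∈ powersetCard i (univ : Finset V),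
          (∑ I ∈ powersetCard r univ with K ⊆ I, x I) ^ 2 := by
    refine sum_nonneg fun i hi => mul_nonneg ?_ (sum_nonneg fun _ _ => sq_nonneg _)
    exact le_trans (mul_nonneg (by positivity) (hpos _)) (hb i 0 (by simp at hi; omega)).1
  -- for `i = r` the only `r`-set containing `K` is `K` itself
  have hlast : ∑ K ∈ powersetCard r (univ : Finset V),
      (∑ I ∈ powersetCard r univ with K ⊆ I, x I) ^ 2 =
      ∑ I ∈ powersetCard r (univ : Finset V), x I ^ 2 := by
    refine sum_congr rfl fun K hK => ?_
    have : (powersetCard r (univ : Finset V)).filter (K ⊆ ·) = {K} := by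
      ext I
      simp only [mem_filter, mem_powersetCard, subset_univ, true_and, mem_singleton] at hK ⊢
      constructor
      · rintro ⟨h1, h2⟩
        exact (eq_of_subset_of_card_le h2 (by omega)).symm
      · rintro rfl
        exact ⟨hK, subset_rfl⟩
    rw [this, sum_singleton]
  rw [hlast]
  have := mul_le_mul_of_nonneg_right (hb r 0 (by simp)).1
    (sum_nonneg fun I (_ : I ∈ powersetCard r (univ : Finset V)) => sq_nonneg (x I))
  simp only [add_zero] at this
  linarith

end InterForms

/-! ### Bilinear forms on tuples -/

/-- The bilinear form of the kernel `W` has operator norm at most `L`, for the Euclidean norms. -/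
def BilinBound {V : Type*} [Fintype V] (W : V → V → ℝ) (L : ℝ) : Prop :=
  ∀ x y : V → ℝ, |∑ a, ∑ b, W a b * x a * y b| ≤ L * √(∑ a, x a ^ 2) * √(∑ b, y b ^ 2)

section Tuples

variable {V ι : Type*} [Fintype V] [Fintype ι] [DecidableEq ι]

/-- Resampling one coordinate of a tuple hits every tuple equally often. -/
theorem sum_sum_update (a : ι) (f : (ι → V) → ℝ) :
    ∑ p, ∑ v, f (Function.update p a v) = Fintype.card V * ∑ p, f p := by
  have h : ∑ z : (ι → V) × V, f (Function.update z.1 a z.2) = ∑ z : (ι → V) × V, f z.1 := by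
    refine sum_nbij' (fun z => (Function.update z.1 a z.2, z.1 a))
      (fun z => (Function.update z.1 a z.2, z.1 a)) ?_ ?_ ?_ ?_ ?_ <;> simp
  rw [Fintype.sum_prod_type, Fintype.sum_prod_type] at h
  rw [h, mul_sum]
  simp

theorem sum_sqrt_fiber_le (a : ι) (F : (ι → V) → ℝ) :
    ∑ p, √(∑ v, F (Function.update p a v) ^ 2) ≤
      √((Fintype.card V : ℝ) ^ Fintype.card ι) * √(Fintype.card V) * √(∑ p, F p ^ 2) := by
  have h := Real.sum_mul_le_sqrt_mul_sqrt (univ : Finset (ι → V)) (fun _ => 1)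
    (fun p => √(∑ v, F (Function.update p a v) ^ 2))
  have h2 : ∀ p : ι → V, √(∑ v, F (Function.update p a v) ^ 2) ^ 2 =
      ∑ v, F (Function.update p a v) ^ 2 := fun p =>
    Real.sq_sqrt (sum_nonneg fun _ _ => sq_nonneg _)
  simp_rw [h2] at h
  rw [sum_sum_update a (fun p => F p ^ 2), Real.sqrt_mul (by positivity)] at h
  simpa [mul_assoc] using h

/-- With all coordinates except `p e₀.1` and `q e₀.2` fixed, the sum is a bilinear form of `W` whose
two vectors absorb all other factors, each of which sees only one of the two free coordinates. -/
theorem abs_sum_tuple_edge_le {W : V → V → ℝ} {L : ℝ} (hL : 0 ≤ L) (hW : BilinBound W L)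
    (F H : (ι → V) → ℝ) (e₀ : ι × ι) (u : ι × ι → V → V → ℝ) (hu : ∀ e v w, |u e v w| ≤ 1) :
    Fintype.card V * |∑ p, ∑ q, F p * H q *
        (W (p e₀.1) (q e₀.2) * ∏ e ∈ univ.erase e₀, u e (p e.1) (q e.2))| ≤
      Fintype.card V ^ Fintype.card ι * L * √(∑ p, F p ^ 2) * √(∑ q, H q ^ 2) := by
  obtain ⟨a, b⟩ := e₀
  set n : ℝ := (Fintype.card V : ℝ) with hn
  set T : (ι → V) → (ι → V) → ℝ := fun p q =>
    F p * H q * (W (p a) (q b) * ∏ e ∈ univ.erase (a, b), u e (p e.1) (q e.2)) with hT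
  have hn0 : 0 ≤ n := by positivity
  rcases hn0.eq_or_lt with h0 | hpos
  · rw [← h0]
    simp only [zero_mul]
    have : (0 : ℝ) ≤ 0 ^ Fintype.card ι := by positivity
    positivity
  have havg : n * (n * ∑ p, ∑ q, T p q) = ∑ p, ∑ q, ∑ v, ∑ w,
      T (Function.update p a v) (Function.update q b w) := by
    have h1 := sum_sum_update a (fun p => ∑ q, T p q)
    have h2 : ∀ p, ∑ q, ∑ w, T p (Function.update q b w) = n * ∑ q, T p q :=
      fun p => sum_sum_update b (fun q => T p q)
    rw [← h1, mul_sum]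
    refine sum_congr rfl fun p _ => ?_
    rw [mul_sum]
    simp_rw [← h2]
    rw [sum_comm]
  have hinner : ∀ p q : ι → V,
      |∑ v, ∑ w, T (Function.update p a v) (Function.update q b w)| ≤
      L * √(∑ v, F (Function.update p a v) ^ 2) * √(∑ w, H (Function.update q b w) ^ 2) := by
    intro p q
    -- every factor other than the one at `(a, b)` depends on at most one of `v` and `w`
    let g : V → ℝ := fun v => ∏ e ∈ univ.erase (a, b), if e.1 = a then u e v (q e.2) else 1
    let h : V → ℝ := fun w => ∏ e ∈ univ.erase (a, b),
      if e.1 = a then 1 else u e (p e.1) (Function.update q b w e.2)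
    have hg : ∀ v, |g v| ≤ 1 := fun v => by
      rw [abs_prod]
      refine prod_le_one (fun _ _ => abs_nonneg _) fun e _ => ?_
      split_ifs
      · exact hu _ _ _
      · simp
    have hh : ∀ w, |h w| ≤ 1 := fun w => by
      rw [abs_prod]
      refine prod_le_one (fun _ _ => abs_nonneg _) fun e _ => ?_
      split_ifs
      · simp
      · exact hu _ _ _
    have hsplit : ∀ v w, T (Function.update p a v) (Function.update q b w) =
        W v w * (F (Function.update p a v) * g v) * (H (Function.update q b w) * h w) := by
      intro v w
      have : ∏ e ∈ univ.erase (a, b),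
          u e (Function.update p a v e.1) (Function.update q b w e.2) = g v * h w := by
        rw [← prod_mul_distrib]
        refine prod_congr rfl fun e he => ?_
        by_cases h1 : e.1 = a
        · have h2 : e.2 ≠ b := fun h2 => (mem_erase.1 he).1 (Prod.ext h1 h2)
          simp [h1, h2]
        · simp [h1]
      simp only [hT, this, Function.update_self]
      ring
    simp_rw [hsplit]
    refine (hW _ _).trans ?_
    have hsq : ∀ (x y : ℝ), |y| ≤ 1 → (x * y) ^ 2 ≤ x ^ 2 := fun x y hy => by
      rw [mul_pow, ← sq_abs y]
      exact mul_le_of_le_one_right (sq_nonneg x) (pow_le_one₀ (abs_nonneg y) hy)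
    have h1 := Real.sqrt_le_sqrt (sum_le_sum fun v (_ : v ∈ univ) =>
      hsq (F (Function.update p a v)) (g v) (hg v))
    have h2 := Real.sqrt_le_sqrt (sum_le_sum fun w (_ : w ∈ univ) =>
      hsq (H (Function.update q b w)) (h w) (hh w))
    exact mul_le_mul (mul_le_mul_of_nonneg_left h1 hL) h2 (Real.sqrt_nonneg _) (by positivity)
  have hmain : n * (n * |∑ p, ∑ q, T p q|) ≤ L * (∑ p, √(∑ v, F (Function.update p a v) ^ 2)) *
      ∑ q, √(∑ w, H (Function.update q b w) ^ 2) := by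
    have habs : n * (n * |∑ p, ∑ q, T p q|) = |n * (n * ∑ p, ∑ q, T p q)| := by
      rw [abs_mul, abs_mul, abs_of_nonneg hn0]
    rw [habs, havg]
    refine (abs_sum_le_sum_abs _ _).trans ?_
    rw [mul_assoc, sum_mul_sum, mul_sum]
    refine sum_le_sum fun p _ => (abs_sum_le_sum_abs _ _).trans ?_
    rw [mul_sum]
    exact sum_le_sum fun q _ => by rw [← mul_assoc]; exact hinner p q
  have hfin : L * (∑ p, √(∑ v, F (Function.update p a v) ^ 2)) *
      ∑ q, √(∑ w, H (Function.update q b w) ^ 2) ≤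
      n * (n ^ Fintype.card ι * L * √(∑ p, F p ^ 2) * √(∑ q, H q ^ 2)) := by
    refine (mul_le_mul (mul_le_mul_of_nonneg_left (sum_sqrt_fiber_le a F) hL)
      (sum_sqrt_fiber_le b H) (sum_nonneg fun _ _ => Real.sqrt_nonneg _) (by positivity)).trans ?_
    have e1 : √(n ^ Fintype.card ι) * √(n ^ Fintype.card ι) = n ^ Fintype.card ι :=
      Real.mul_self_sqrt (by positivity)
    have e2 : √n * √n = n := Real.mul_self_sqrt hn0
    refine le_of_eq ?_
    calc _ = L * (√(n ^ Fintype.card ι) * √(n ^ Fintype.card ι)) * (√n * √n) *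
          √(∑ p, F p ^ 2) * √(∑ q, H q ^ 2) := by ring
      _ = _ := by rw [e1, e2]; ring
  exact le_of_mul_le_mul_left (hmain.trans hfin) hpos

/-- The factors `α` are replaced by `β` one pair of positions at a time; each replacement costs one
factor `α - β`, which has small operator norm. -/
theorem abs_sum_tuple_prod_sub_prod_le {α β : V → V → ℝ} {L : ℝ} (hL : 0 ≤ L)
    (hW : BilinBound (fun v w => α v w - β v w) L) (hα : ∀ v w, |α v w| ≤ 1)
    (hβ : ∀ v w, |β v w| ≤ 1) (F H : (ι → V) → ℝ) :
    Fintype.card V * |∑ p, ∑ q, F p * H q *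
        ((∏ e : ι × ι, α (p e.1) (q e.2)) - ∏ e : ι × ι, β (p e.1) (q e.2))| ≤
      Fintype.card ι ^ 2 * (Fintype.card V ^ Fintype.card ι * L *
        √(∑ p, F p ^ 2) * √(∑ q, H q ^ 2)) := by
  set n : ℝ := (Fintype.card V : ℝ) with hn
  set R := n ^ Fintype.card ι * L * √(∑ p, F p ^ 2) * √(∑ q, H q ^ 2)
  have key : ∀ S : Finset (ι × ι), n * |∑ p, ∑ q, F p * H q *
      ((∏ e : ι × ι, if e ∈ S then α (p e.1) (q e.2) else β (p e.1) (q e.2)) -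
        ∏ e : ι × ι, β (p e.1) (q e.2))| ≤ #S * R := by
    intro S
    induction S using Finset.induction_on with
    | empty => simp
    | insert e₀ S he ih =>
      have h1 := abs_sum_tuple_edge_le hL hW F H e₀
        (fun e v w => if e ∈ S then α v w else β v w)
        (fun e v w => by split_ifs; exacts [hα v w, hβ v w])
      have hstep : ∀ p q : ι → V, F p * H q *
          ((∏ e : ι × ι, if e ∈ insert e₀ S then α (p e.1) (q e.2) else β (p e.1) (q e.2)) -
            ∏ e : ι × ι, β (p e.1) (q e.2)) = F p * H q *
          ((α (p e₀.1) (q e₀.2) - β (p e₀.1) (q e₀.2)) *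
            ∏ e ∈ univ.erase e₀, if e ∈ S then α (p e.1) (q e.2) else β (p e.1) (q e.2)) +
          F p * H q *
          ((∏ e : ι × ι, if e ∈ S then α (p e.1) (q e.2) else β (p e.1) (q e.2)) -
            ∏ e : ι × ι, β (p e.1) (q e.2)) := by
        intro p q
        rw [← mul_prod_erase univ _ (mem_univ e₀),
          ← mul_prod_erase univ (fun e => if e ∈ S then α (p e.1) (q e.2) else β (p e.1) (q e.2))
            (mem_univ e₀)]
        have : ∏ e ∈ univ.erase e₀,
            (if e ∈ insert e₀ S then α (p e.1) (q e.2) else β (p e.1) (q e.2)) =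
            ∏ e ∈ univ.erase e₀, if e ∈ S then α (p e.1) (q e.2) else β (p e.1) (q e.2) :=
          prod_congr rfl fun e he' => by simp [mem_insert, (mem_erase.1 he').1]
        rw [this]
        simp only [mem_insert_self, he, if_true, if_false]
        ring
      simp_rw [hstep, sum_add_distrib]
      refine (mul_le_mul_of_nonneg_left (abs_add_le _ _) (by positivity)).trans ?_
      rw [card_insert_of_notMem he, mul_add]
      push_cast
      linarith
  have := key univ
  simpa [sq] using this

end Tuples

/-! ### Bilinear forms on subsets -/

section Subsets

variable {V : Type*} [Fintype V] [LinearOrder V]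

open Classical in
/-- Strictly increasing `s`-tuples avoiding `K`; they encode the `s`-sets disjoint from `K`. -/
def sortedTuples (K : Finset V) (s : ℕ) : Finset (Fin s → V) :=
  univ.filter fun p => StrictMono p ∧ Disjoint K (univ.image p)

theorem mem_sortedTuples {K : Finset V} {s : ℕ} {p : Fin s → V} :
    p ∈ sortedTuples K s ↔ StrictMono p ∧ Disjoint K (univ.image p) := by
  simp [sortedTuples]

/-- Each `r`-set containing `K` is `K` together with the entries of exactly one sorted tuple. -/
theorem sum_superset_eq_sum_sortedTuples {K : Finset V} {r s : ℕ} (hr : #K + s = r)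
    (f : Finset V → ℝ) :
    ∑ I ∈ powersetCard r univ with K ⊆ I, f I =
      ∑ p ∈ sortedTuples K s, f (K ∪ univ.image p) := by
  symm
  refine sum_bij (fun p _ => K ∪ univ.image p) ?_ ?_ ?_ (fun _ _ => rfl)
  · intro p hp
    rw [mem_sortedTuples] at hp
    simp only [mem_filter, mem_powersetCard, subset_univ, true_and, subset_union_left, and_true]
    rw [card_union_of_disjoint hp.2, card_image_of_injective _ hp.1.injective]
    simpa using hr
  · intro p hp q hq h
    rw [mem_sortedTuples] at hp hq
    have h1 : univ.image p = univ.image q := by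
      rw [← union_sdiff_cancel_left hp.2, ← union_sdiff_cancel_left hq.2, h]
    refine (hp.1.range_inj hq.1).1 ?_
    have := congrArg (fun S : Finset V => (S : Set V)) h1
    simpa using this
  · intro I hI
    simp only [mem_filter, mem_powersetCard, subset_univ, true_and] at hI
    have hc : #(I \ K) = s := by rw [card_sdiff_of_subset hI.2]; omega
    refine ⟨(I \ K).orderEmbOfFin hc, ?_, ?_⟩
    · rw [mem_sortedTuples, image_orderEmbOfFin_univ]
      exact ⟨((I \ K).orderEmbOfFin hc).strictMono, disjoint_sdiff⟩
    · simp only [image_orderEmbOfFin_univ]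
      exact union_sdiff_of_subset hI.2

/-- Pairs with a prescribed intersection `K` are pairs of sorted tuples with disjoint images. The
disjointness is encoded in the zero diagonals of `α` and of the kernel `1 / 2` off the diagonal. -/
theorem abs_sum_inter_eq_le {α : V → V → ℝ} {L : ℝ} (hL : 0 ≤ L)
    (hW : BilinBound (fun v w => α v w - if v = w then 0 else 1 / 2) L)
    (hα : ∀ v w, |α v w| ≤ 1) (hα0 : ∀ v, α v v = 0) {K : Finset V} {r s : ℕ} (hr : #K + s = r)
    (x : Finset V → ℝ) :
    Fintype.card V * |∑ I ∈ powersetCard r univ, ∑ J ∈ powersetCard r univ,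
        if I ∩ J = K then x I * x J * ((∏ a ∈ I \ J, ∏ b ∈ J \ I, α a b) - (1 / 2) ^ (s ^ 2))
        else 0| ≤
      s ^ 2 * Fintype.card V ^ s * L * ∑ I ∈ powersetCard r univ with K ⊆ I, x I ^ 2 := by
  classical
  set β : V → V → ℝ := fun v w => if v = w then 0 else 1 / 2 with hβ
  set F : (Fin s → V) → ℝ := fun p => if p ∈ sortedTuples K s then x (K ∪ univ.image p) else 0
    with hF
  have hβ1 : ∀ v w, |β v w| ≤ 1 := fun v w => by
    simp only [hβ]; split_ifs <;> norm_num
  have hmain := abs_sum_tuple_prod_sub_prod_le (ι := Fin s) hL hW hα hβ1 F F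
  have hFsq : ∑ p, F p ^ 2 = ∑ I ∈ powersetCard r univ with K ⊆ I, x I ^ 2 := by
    rw [sum_superset_eq_sum_sortedTuples hr (fun I => x I ^ 2)]
    simp [hF, ite_pow]
  have hform : (∑ I ∈ powersetCard r univ, ∑ J ∈ powersetCard r univ,
        if I ∩ J = K then x I * x J * ((∏ a ∈ I \ J, ∏ b ∈ J \ I, α a b) - (1 / 2) ^ (s ^ 2))
        else 0) = ∑ p, ∑ q, F p * F q *
        ((∏ e : Fin s × Fin s, α (p e.1) (q e.2)) - ∏ e : Fin s × Fin s, β (p e.1) (q e.2)) := by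
    set g : Finset V → Finset V → ℝ := fun I J =>
      if I ∩ J = K then x I * x J * ((∏ a ∈ I \ J, ∏ b ∈ J \ I, α a b) - (1 / 2) ^ (s ^ 2))
        else 0 with hg
    have h1 : ∑ I ∈ powersetCard r univ, ∑ J ∈ powersetCard r univ, g I J =
        ∑ p ∈ sortedTuples K s, ∑ q ∈ sortedTuples K s,
          g (K ∪ univ.image p) (K ∪ univ.image q) := by
      have hI : ∀ I, ∑ J ∈ powersetCard r univ, g I J =
          ∑ q ∈ sortedTuples K s, g I (K ∪ univ.image q) := fun I => by
        rw [← sum_superset_eq_sum_sortedTuples hr (fun J => g I J)]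
        refine (sum_filter_of_ne fun J _ hJ => ?_).symm
        simp only [hg, ne_eq, ite_eq_right_iff, Classical.not_imp] at hJ
        exact hJ.1 ▸ inter_subset_right
      simp_rw [hI]
      rw [← sum_superset_eq_sum_sortedTuples hr
        (fun I => ∑ q ∈ sortedTuples K s, g I (K ∪ univ.image q))]
      refine (sum_filter_of_ne fun I _ hJ => ?_).symm
      obtain ⟨q, _, hq⟩ := exists_ne_zero_of_sum_ne_zero hJ
      simp only [hg, ne_eq, ite_eq_right_iff, Classical.not_imp] at hq
      exact hq.1 ▸ inter_subset_left
    rw [h1]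
    have h2 : ∀ p q : Fin s → V, F p * F q *
        ((∏ e : Fin s × Fin s, α (p e.1) (q e.2)) - ∏ e : Fin s × Fin s, β (p e.1) (q e.2)) =
        if p ∈ sortedTuples K s then (if q ∈ sortedTuples K s then
          g (K ∪ univ.image p) (K ∪ univ.image q) else 0) else 0 := by
      intro p q
      by_cases hp : p ∈ sortedTuples K s
      swap
      · simp [hF, hp]
      by_cases hq : q ∈ sortedTuples K s
      swap
      · simp [hF, hq]
      simp only [hF, hp, hq, if_true, hg]
      rw [mem_sortedTuples] at hp hq
      rw [← union_inter_distrib_left]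
      by_cases hd : Disjoint (univ.image p) (univ.image q)
      · have e1 : (K ∪ univ.image p) \ (K ∪ univ.image q) = univ.image p := by
          ext v
          have h1 := fun h : v ∈ univ.image p => disjoint_left.1 hd h
          have h2 := fun h : v ∈ K => disjoint_left.1 hp.2 h
          simp only [mem_sdiff, mem_union]
          tauto
        have e2 : (K ∪ univ.image q) \ (K ∪ univ.image p) = univ.image q := by
          ext v
          have h1 := fun h : v ∈ univ.image p => disjoint_left.1 hd h
          have h2 := fun h : v ∈ K => disjoint_left.1 hq.2 h
          simp only [mem_sdiff, mem_union]
          tauto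
        have hne : ∀ a b, p a ≠ q b := fun a b hab =>
          disjoint_left.1 hd (mem_image_of_mem p (mem_univ a))
            (hab ▸ mem_image_of_mem q (mem_univ b))
        rw [if_pos (by rw [disjoint_iff_inter_eq_empty.1 hd, union_empty]), e1, e2,
          prod_image hp.1.injective.injOn]
        simp_rw [prod_image hq.1.injective.injOn, Fintype.prod_prod_type, hβ]
        simp [hne, sq, pow_mul]
      · rw [if_neg]
        · -- a common entry of `p` and `q` makes both products vanish
          obtain ⟨v, hv, hv'⟩ := not_disjoint_iff.1 hd
          obtain ⟨a, -, rfl⟩ := mem_image.1 hv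
          obtain ⟨b, -, hb⟩ := mem_image.1 hv'
          rw [prod_eq_zero (mem_univ (a, b)) (by simp [hb, hα0]),
            prod_eq_zero (mem_univ (a, b)) (by simp [hb, hβ])]
          simp
        · intro h
          apply hd
          rw [disjoint_left]
          intro v hv hv'
          have : v ∈ K := h ▸ mem_union_right _ (mem_inter.2 ⟨hv, hv'⟩)
          exact disjoint_left.1 hp.2 this hv
    simp_rw [h2]
    simp
  rw [hform]
  refine hmain.trans (le_of_eq ?_)
  rw [hFsq, mul_assoc _ (√_) (√_), Real.mul_self_sqrt (sum_nonneg fun _ _ => sq_nonneg _)]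
  simp
  ring

theorem sum_superset_sq (r i : ℕ) (x : Finset V → ℝ) :
    ∑ K ∈ powersetCard i (univ : Finset V), ∑ I ∈ powersetCard r univ with K ⊆ I, x I ^ 2 =
      r.choose i * ∑ I ∈ powersetCard r univ, x I ^ 2 := by
  simp_rw [sum_filter]
  rw [sum_comm, mul_sum]
  refine sum_congr rfl fun I hI => ?_
  rw [← sum_filter, sum_const, nsmul_eq_mul, ← (mem_powersetCard.1 hI).2, ← card_powersetCard]
  congr 3
  ext K
  simp [mem_powersetCard, and_comm]

theorem abs_sum_card_inter_eq_le {α : V → V → ℝ} {L : ℝ} (hL : 0 ≤ L)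
    (hW : BilinBound (fun v w => α v w - if v = w then 0 else 1 / 2) L)
    (hα : ∀ v w, |α v w| ≤ 1) (hα0 : ∀ v, α v v = 0) {i r s : ℕ} (hr : i + s = r)
    (x : Finset V → ℝ) :
    Fintype.card V * |∑ I ∈ powersetCard r univ, ∑ J ∈ powersetCard r univ,
        if #(I ∩ J) = i then x I * x J * ((∏ a ∈ I \ J, ∏ b ∈ J \ I, α a b) - (1 / 2) ^ (s ^ 2))
        else 0| ≤
      s ^ 2 * r.choose i * Fintype.card V ^ s * L * ∑ I ∈ powersetCard r univ, x I ^ 2 := by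
  set g : Finset V → Finset V → ℝ := fun I J =>
    x I * x J * ((∏ a ∈ I \ J, ∏ b ∈ J \ I, α a b) - (1 / 2) ^ (s ^ 2)) with hg
  have h : ∑ I ∈ powersetCard r univ, ∑ J ∈ powersetCard r univ,
      (if #(I ∩ J) = i then g I J else 0) = ∑ K ∈ powersetCard i (univ : Finset V),
      ∑ I ∈ powersetCard r univ, ∑ J ∈ powersetCard r univ,
        if I ∩ J = K then g I J else 0 := by
    symm
    rw [sum_comm]
    refine sum_congr rfl fun I _ => ?_
    rw [sum_comm]
    refine sum_congr rfl fun J _ => ?_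
    rw [sum_ite_eq]
    simp [mem_powersetCard]
  rw [h]
  refine (mul_le_mul_of_nonneg_left (abs_sum_le_sum_abs _ _) (by positivity)).trans ?_
  rw [mul_sum]
  refine (sum_le_sum fun K hK => abs_sum_inter_eq_le hL hW hα hα0
    (by rw [(mem_powersetCard.1 hK).2]; exact hr) x).trans (le_of_eq ?_)
  rw [← mul_sum, sum_superset_sq]
  ring

end Subsets

/-! ### Counting clique extensions -/

section CliqueExtensions

variable {V : Type*} [Fintype V] [DecidableEq V] (G : SimpleGraph V)

open Classical in
/-- The vertices adjacent to every vertex of `U`; such a vertex is never in `U`. -/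
noncomputable def commonNbrs (U : Finset V) : Finset V :=
  univ.filter fun z => ∀ u ∈ U, G.Adj u z

open Classical in
/-- The `i`-cliques of `G` all of whose vertices are adjacent to every vertex of `U`. No condition
is put on the edges inside `U`. -/
noncomputable def cliqueExtensions (i : ℕ) (U : Finset V) : Finset (Finset V) :=
  (powersetCard i univ).filter fun Z =>
    G.IsClique (Z : Set V) ∧ ∀ z ∈ Z, ∀ u ∈ U, G.Adj u z

/-- The number of cliques of size `i` completely joined to a given `u`-set in an ideal
pseudorandom graph of density `1/2` on `n` vertices, up to lower order terms:
`i * u + i.choose 2` edges have to be present. -/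
noncomputable def cliqueMainTerm (n i u : ℕ) : ℝ :=
  (n : ℝ) ^ i / i.factorial / 2 ^ (i * u + i.choose 2)

variable {G}

theorem mem_commonNbrs {U : Finset V} {z : V} : z ∈ commonNbrs G U ↔ ∀ u ∈ U, G.Adj u z := by
  simp [commonNbrs]

theorem mem_cliqueExtensions {i : ℕ} {U Z : Finset V} : Z ∈ cliqueExtensions G i U ↔
    #Z = i ∧ G.IsClique (Z : Set V) ∧ ∀ z ∈ Z, ∀ u ∈ U, G.Adj u z := by
  simp [cliqueExtensions, mem_powersetCard]

theorem disjoint_of_mem_cliqueExtensions {i : ℕ} {U Z : Finset V}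
    (h : Z ∈ cliqueExtensions G i U) : Disjoint U Z := by
  rw [mem_cliqueExtensions] at h
  rw [disjoint_left]
  exact fun a ha ha' => G.irrefl (h.2.2 a ha' a ha)

/-- Double counting of an extension together with one of its vertices. -/
theorem sum_card_cliqueExtensions_insert (i : ℕ) (U : Finset V) :
    ∑ z ∈ commonNbrs G U, #(cliqueExtensions G i (insert z U)) =
      (i + 1) * #(cliqueExtensions G (i + 1) U) := by
  classical
  have h1 : (i + 1) * #(cliqueExtensions G (i + 1) U) =
      ∑ Z ∈ cliqueExtensions G (i + 1) U, #Z := by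
    rw [sum_congr rfl fun Z hZ => (mem_cliqueExtensions.1 hZ).1, sum_const, smul_eq_mul, mul_comm]
  rw [h1, ← card_sigma, ← card_sigma]
  refine card_bij' (fun p _ => ⟨insert p.1 p.2, p.1⟩) (fun p _ => ⟨p.2, p.1.erase p.2⟩) ?_ ?_ ?_ ?_
  · rintro ⟨z, Z⟩ h
    simp only [mem_sigma, mem_commonNbrs, mem_cliqueExtensions, mem_insert] at h ⊢
    obtain ⟨hz, hc, hcl, hZ⟩ := h
    have hzZ : z ∉ Z := fun hzZ => G.irrefl (hZ z hzZ z (Or.inl rfl))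
    refine ⟨⟨by rw [card_insert_of_notMem hzZ, hc], ?_, ?_⟩, by simp⟩
    · rw [coe_insert, SimpleGraph.isClique_insert]
      exact ⟨hcl, fun b hb _ => hZ b hb z (Or.inl rfl)⟩
    · rintro b (rfl | hb) u hu
      · exact hz u hu
      · exact hZ b hb u (Or.inr hu)
  · rintro ⟨Z, z⟩ h
    simp only [mem_sigma, mem_commonNbrs, mem_cliqueExtensions, mem_insert] at h ⊢
    obtain ⟨⟨hc, hcl, hZ⟩, hz⟩ := h
    refine ⟨hZ z hz, by rw [card_erase_of_mem hz, hc]; rfl, hcl.subset (by simp), ?_⟩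
    rintro b hb u (rfl | hu)
    · exact hcl hz (mem_of_mem_erase hb) (ne_of_mem_erase hb).symm
    · exact hZ b (mem_of_mem_erase hb) u hu
  · rintro ⟨z, Z⟩ h
    simp only [mem_sigma, mem_cliqueExtensions] at h
    have hzZ : z ∉ Z := fun hzZ => G.irrefl (h.2.2.2 z hzZ z (mem_insert_self _ _))
    simp [erase_insert hzZ]
  · rintro ⟨Z, z⟩ h
    simp only [mem_sigma] at h
    simp [insert_erase h.2]

theorem cliqueMainTerm_nonneg (n i u : ℕ) : 0 ≤ cliqueMainTerm n i u := by
  unfold cliqueMainTerm; positivity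

theorem cliqueMainTerm_le (n i u : ℕ) : cliqueMainTerm n i u ≤ (n : ℝ) ^ i := by
  unfold cliqueMainTerm
  refine (div_le_self (by positivity) (one_le_pow₀ (by norm_num))).trans
    (div_le_self (by positivity) ?_)
  exact_mod_cast i.factorial_pos

theorem cliqueMainTerm_succ (n i u : ℕ) :
    (i + 1) * cliqueMainTerm n (i + 1) u = n / 2 ^ u * cliqueMainTerm n i (u + 1) := by
  unfold cliqueMainTerm
  have h : (i + 1) * u + (i + 1).choose 2 = u + (i * (u + 1) + i.choose 2) := by
    rw [Nat.choose_succ_succ' i 1, Nat.choose_one_right]; ring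
  rw [h, Nat.factorial_succ, pow_add 2 u]
  push_cast
  field_simp
  ring

/-- In a graph whose small sets have the expected number of common neighbours, the cliques completely
joined to a set are built vertex by vertex, each step contributing one error of relative size
`d / n`. -/
theorem abs_card_cliqueExtensions_sub_le {d : ℝ} {m : ℕ}
    (hN : ∀ U : Finset V, #U < m → |(#(commonNbrs G U) : ℝ) - Fintype.card V / 2 ^ #U| ≤ d)
    (i : ℕ) : ∀ U : Finset V, #U + i ≤ m →
    Fintype.card V * |(#(cliqueExtensions G i U) : ℝ) - cliqueMainTerm (Fintype.card V) i #U| ≤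
      i * Fintype.card V ^ i * d := by
  set n := Fintype.card V with hn
  induction i with
  | zero =>
    intro U _
    have : cliqueExtensions G 0 U = {∅} := by
      ext Z
      rw [mem_cliqueExtensions, mem_singleton, card_eq_zero]
      constructor
      · exact fun h => h.1
      · rintro rfl; simp
    simp [this, cliqueMainTerm]
  | succ i ih =>
    intro U hU
    have hd := hN U (by omega)
    have hd0 : 0 ≤ d := (abs_nonneg _).trans hd
    have hcard : (i + 1 : ℝ) * (#(cliqueExtensions G (i + 1) U)) =
        ∑ z ∈ commonNbrs G U, (#(cliqueExtensions G i (insert z U)) : ℝ) := by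
      exact_mod_cast (sum_card_cliqueExtensions_insert i U).symm
    have hmain := cliqueMainTerm_succ n i #U
    have hsplit : (i + 1 : ℝ) *
        ((#(cliqueExtensions G (i + 1) U) : ℝ) - cliqueMainTerm n (i + 1) #U) =
        ∑ z ∈ commonNbrs G U, ((#(cliqueExtensions G i (insert z U)) : ℝ) -
          cliqueMainTerm n i (#U + 1)) +
        ((#(commonNbrs G U) : ℝ) - n / 2 ^ #U) * cliqueMainTerm n i (#U + 1) := by
      rw [mul_sub, hcard, hmain, sum_sub_distrib, sum_const, nsmul_eq_mul]
      ring
    have h1 : (n : ℝ) * |∑ z ∈ commonNbrs G U, ((#(cliqueExtensions G i (insert z U)) : ℝ) -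
          cliqueMainTerm n i (#U + 1))| ≤ n * (i * n ^ i * d) := by
      refine (mul_le_mul_of_nonneg_left (abs_sum_le_sum_abs _ _) (by positivity)).trans ?_
      rw [mul_sum]
      refine (sum_le_card_nsmul _ _ (i * n ^ i * d) fun z hz => ?_).trans ?_
      · have hzU : z ∉ U := fun h => G.irrefl (mem_commonNbrs.1 hz z h)
        have := ih (insert z U) (by rw [card_insert_of_notMem hzU]; omega)
        rwa [card_insert_of_notMem hzU] at this
      · rw [nsmul_eq_mul]
        have : #(commonNbrs G U) ≤ n := card_le_univ _
        gcongr
    have h2 : (n : ℝ) * |((#(commonNbrs G U) : ℝ) - n / 2 ^ #U) *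
        cliqueMainTerm n i (#U + 1)| ≤ n * (d * n ^ i) := by
      rw [abs_mul, abs_of_nonneg (cliqueMainTerm_nonneg _ _ _)]
      have := cliqueMainTerm_le n i (#U + 1)
      have := cliqueMainTerm_nonneg n i (#U + 1)
      gcongr
    set X := |(#(cliqueExtensions G (i + 1) U) : ℝ) - cliqueMainTerm n (i + 1) #U| with hX
    have h3 : (i + 1 : ℝ) * X ≤ |∑ z ∈ commonNbrs G U,
        ((#(cliqueExtensions G i (insert z U)) : ℝ) - cliqueMainTerm n i (#U + 1))| +
        |((#(commonNbrs G U) : ℝ) - n / 2 ^ #U) * cliqueMainTerm n i (#U + 1)| := by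
      refine le_trans (le_of_eq ?_) (abs_add_le _ _)
      rw [← hsplit, abs_mul, abs_of_nonneg (by positivity : (0 : ℝ) ≤ i + 1)]
    have h4 : (n : ℝ) * X ≤ n * ((i + 1) * X) := by
      have : (0 : ℝ) ≤ X := abs_nonneg _
      gcongr
      nlinarith [(Nat.cast_nonneg i : (0 : ℝ) ≤ i)]
    have h5 := mul_le_mul_of_nonneg_left h3 (Nat.cast_nonneg n : (0 : ℝ) ≤ n)
    rw [mul_add] at h5
    push_cast
    calc (n : ℝ) * X ≤ n * (i * n ^ i * d) + n * (d * n ^ i) := by linarith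
      _ = _ := by ring

open Classical in
/-- The adjacency matrix of `G` as a real kernel. -/
noncomputable def adjInd (G : SimpleGraph V) (a b : V) : ℝ := if G.Adj a b then 1 else 0

open Classical in
theorem prod_adjInd (P Q : Finset V) : ∏ a ∈ P, ∏ b ∈ Q, adjInd G a b =
    if ∀ a ∈ P, ∀ b ∈ Q, G.Adj a b then 1 else 0 := by
  unfold adjInd
  have h : ∀ a, (∏ b ∈ Q, if G.Adj a b then (1 : ℝ) else 0) =
      if ∀ b ∈ Q, G.Adj a b then 1 else 0 := fun a => by rw [prod_ite_zero]; simp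
  rw [prod_congr rfl fun a _ => h a, prod_ite_zero]
  simp

end CliqueExtensions

open Classical in
/-- If `U` is a clique, the cliques counted by `cliqueDeg G r U` are `U` together with an extension;
otherwise there are none. -/
theorem cliqueDeg_eq {n : ℕ} (G : SimpleGraph (Fin n)) {r i : ℕ} {U : Finset (Fin n)}
    (hU : #U + i = 2 * r) :
    cliqueDeg G r U = if G.IsClique (U : Set (Fin n)) then #(cliqueExtensions G i U) else 0 := by
  unfold cliqueDeg
  split_ifs with hcl
  · rw [← Set.ncard_coe_finset]
    refine Set.ncard_congr (fun S _ => S \ U) ?_ ?_ ?_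
    · rintro S ⟨h1, h2, h3⟩
      rw [mem_coe, mem_cliqueExtensions]
      refine ⟨by rw [card_sdiff_of_subset h1]; omega, h3.subset (by simp), ?_⟩
      intro z hz u hu
      rw [mem_sdiff] at hz
      exact h3 (h1 hu) hz.1 (fun h => hz.2 (h ▸ hu))
    · rintro S T ⟨h1, -⟩ ⟨h2, -⟩ h
      rw [← union_sdiff_of_subset h1, ← union_sdiff_of_subset h2]
      exact congrArg (U ∪ ·) h
    · intro Z hZ
      rw [mem_coe] at hZ
      have hd := disjoint_of_mem_cliqueExtensions hZ
      rw [mem_cliqueExtensions] at hZ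
      refine ⟨U ∪ Z, ⟨subset_union_left, by rw [card_union_of_disjoint hd]; omega, ?_⟩,
        union_sdiff_cancel_left hd⟩
      rw [coe_union]
      rintro a (ha | ha) b (hb | hb) hab
      · exact hcl ha hb hab
      · exact hZ.2.2 b hb a ha
      · exact (hZ.2.2 a ha b hb).symm
      · exact hZ.2.1 ha hb hab
  · rw [Set.ncard_eq_zero, Set.eq_empty_iff_forall_notMem]
    rintro S ⟨h1, -, h3⟩
    exact hcl (h3.subset (by simpa using h1))

open Classical in
/-- Masking the rows and columns that do not belong to cliques, the edges inside `I` and inside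
`J` may be ignored. -/
theorem cliqueDeg_union {n : ℕ} (G : SimpleGraph (Fin n)) {r : ℕ} {I J : Finset (Fin n)}
    (hI : #I = r) (hJ : #J = r) :
    (cliqueDeg G r (I ∪ J) : ℝ) = (if G.IsClique (I : Set (Fin n)) then 1 else 0) *
      (if G.IsClique (J : Set (Fin n)) then 1 else 0) *
      ((∏ a ∈ I \ J, ∏ b ∈ J \ I, adjInd G a b) * #(cliqueExtensions G #(I ∩ J) (I ∪ J))) := by
  rw [cliqueDeg_eq G (i := #(I ∩ J)) (by rw [card_union_add_card_inter]; omega), prod_adjInd]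
  by_cases h1 : G.IsClique (I : Set (Fin n))
  swap
  · have : ¬ G.IsClique ((I ∪ J : Finset (Fin n)) : Set (Fin n)) :=
      fun h => h1 (h.subset (by simp))
    rw [if_neg this]; simp [h1]
  by_cases h2 : G.IsClique (J : Set (Fin n))
  swap
  · have : ¬ G.IsClique ((I ∪ J : Finset (Fin n)) : Set (Fin n)) :=
      fun h => h2 (h.subset (by simp))
    rw [if_neg this]; simp [h2]
  have h3 : G.IsClique ((I ∪ J : Finset (Fin n)) : Set (Fin n)) ↔
      ∀ a ∈ I \ J, ∀ b ∈ J \ I, G.Adj a b := by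
    constructor
    · intro h a ha b hb
      rw [mem_sdiff] at ha hb
      exact h (by simp [ha.1]) (by simp [hb.1]) (fun h => hb.2 (h ▸ ha.1))
    · intro h a ha b hb hab
      rw [mem_coe, mem_union] at ha hb
      by_cases haI : a ∈ I <;> by_cases haJ : a ∈ J <;> by_cases hbI : b ∈ I <;>
        by_cases hbJ : b ∈ J <;>
        first
        | exact h1 haI hbI hab
        | exact h2 haJ hbJ hab
        | exact h a (mem_sdiff.2 ⟨haI, haJ⟩) b (mem_sdiff.2 ⟨hbJ, hbI⟩)
        | exact (h b (mem_sdiff.2 ⟨hbI, hbJ⟩) a (mem_sdiff.2 ⟨haJ, haI⟩)).symm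
        | (exfalso; tauto)
  rw [if_pos h1, if_pos h2]
  by_cases h : ∀ a ∈ I \ J, ∀ b ∈ J \ I, G.Adj a b
  · rw [if_pos (h3.2 h), if_pos h]; simp
  · rw [if_neg (mt h3.1 h), if_neg h]; simp

/-! ### Concentration for the random graph -/

section SignFlips

variable {Ω ι : Type*} [Fintype Ω] [DecidableEq ι]

/-- Moment generating function bound for variables that can be negated one at a time by bijections of
the sample space. This property replaces independence in Hoeffding's inequality. -/
theorem sum_exp_le_of_flips (X : ι → Ω → ℝ) (σ : ι → Equiv.Perm Ω) (hX : ∀ i ω, |X i ω| ≤ 1)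
    (t : ℝ) (s : Finset ι) (hneg : ∀ i ∈ s, ∀ ω, X i (σ i ω) = -X i ω)
    (hfix : ∀ i ∈ s, ∀ j ∈ s, i ≠ j → ∀ ω, X j (σ i ω) = X j ω) :
    ∑ ω, Real.exp (t * ∑ i ∈ s, X i ω) ≤ Real.exp (t ^ 2 * #s / 2) * Fintype.card Ω := by
  induction s using Finset.induction_on with
  | empty => simp
  | insert i s hi ih =>
    have ih' := ih (fun j hj => hneg j (mem_insert_of_mem hj))
      (fun j hj k hk => hfix j (mem_insert_of_mem hj) k (mem_insert_of_mem hk))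
    have h1 : ∑ ω, Real.exp (t * ∑ j ∈ insert i s, X j ω) =
        ∑ ω, Real.exp (t * X i ω) * Real.exp (t * ∑ j ∈ s, X j ω) := by
      refine sum_congr rfl fun ω _ => ?_
      rw [sum_insert hi, mul_add, Real.exp_add]
    have h2 : ∑ ω, Real.exp (t * X i ω) * Real.exp (t * ∑ j ∈ s, X j ω) =
        ∑ ω, Real.exp (-(t * X i ω)) * Real.exp (t * ∑ j ∈ s, X j ω) := by
      rw [← Equiv.sum_comp (σ i)]
      refine sum_congr rfl fun ω _ => ?_
      rw [hneg i (mem_insert_self _ _), mul_neg, sum_congr rfl fun j hj =>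
        hfix i (mem_insert_self _ _) j (mem_insert_of_mem hj) (fun h => hi (h ▸ hj)) ω]
    -- averaging over the flip turns the factor of `i` into a hyperbolic cosine
    have h3 : ∑ ω, Real.exp (t * ∑ j ∈ insert i s, X j ω) =
        ∑ ω, Real.cosh (t * X i ω) * Real.exp (t * ∑ j ∈ s, X j ω) := by
      have : ∀ ω, Real.cosh (t * X i ω) * Real.exp (t * ∑ j ∈ s, X j ω) =
          (Real.exp (t * X i ω) * Real.exp (t * ∑ j ∈ s, X j ω)) / 2 +
          (Real.exp (-(t * X i ω)) * Real.exp (t * ∑ j ∈ s, X j ω)) / 2 := fun ω => by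
        rw [Real.cosh_eq]; ring
      simp_rw [this]
      rw [sum_add_distrib, ← sum_div, ← sum_div, ← h2, h1]
      ring
    rw [h3]
    have h4 : ∀ ω, Real.cosh (t * X i ω) ≤ Real.exp (t ^ 2 / 2) := fun ω => by
      refine (Real.cosh_le_exp_half_sq _).trans (Real.exp_le_exp.2 ?_)
      have : X i ω ^ 2 ≤ 1 := (sq_le_one_iff_abs_le_one _).2 (hX i ω)
      rw [mul_pow]
      nlinarith [sq_nonneg t]
    calc _ ≤ ∑ ω, Real.exp (t ^ 2 / 2) * Real.exp (t * ∑ j ∈ s, X j ω) :=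
          sum_le_sum fun ω _ => mul_le_mul_of_nonneg_right (h4 ω) (Real.exp_pos _).le
      _ ≤ Real.exp (t ^ 2 / 2) * (Real.exp (t ^ 2 * #s / 2) * Fintype.card Ω) := by
          rw [← mul_sum]
          exact mul_le_mul_of_nonneg_left ih' (Real.exp_pos _).le
      _ = _ := by
          rw [← mul_assoc, ← Real.exp_add, card_insert_of_notMem hi]
          push_cast
          congr 2
          ring

open Classical in
/-- Hoeffding's inequality, as a count of sample points. -/
theorem card_le_sum_of_flips (X : ι → Ω → ℝ) (σ : ι → Equiv.Perm Ω) (hX : ∀ i ω, |X i ω| ≤ 1)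
    (s : Finset ι) (hneg : ∀ i ∈ s, ∀ ω, X i (σ i ω) = -X i ω)
    (hfix : ∀ i ∈ s, ∀ j ∈ s, i ≠ j → ∀ ω, X j (σ i ω) = X j ω)
    {a m : ℝ} (ha : 0 ≤ a) (hm : 0 < m) (hs : #s ≤ m) :
    (#{ω | a ≤ ∑ i ∈ s, X i ω} : ℝ) ≤ Real.exp (-(a ^ 2 / (2 * m))) * Fintype.card Ω := by
  have h := sum_exp_le_of_flips X σ hX (a / m) s hneg hfix
  have h1 : (#{ω | a ≤ ∑ i ∈ s, X i ω} : ℝ) * Real.exp (a / m * a) ≤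
      ∑ ω, Real.exp (a / m * ∑ i ∈ s, X i ω) := by
    rw [← nsmul_eq_mul]
    refine (card_nsmul_le_sum _ _ _ fun ω hω => ?_).trans
      (sum_le_sum_of_subset_of_nonneg (subset_univ _) fun _ _ _ => (Real.exp_pos _).le)
    have : 0 ≤ a / m := by positivity
    have := (mem_filter.1 hω).2
    gcongr
  have h2 : Real.exp ((a / m) ^ 2 * #s / 2) ≤ Real.exp ((a / m) ^ 2 * m / 2) := by gcongr
  have h3 : Real.exp (-(a ^ 2 / (2 * m))) =
      Real.exp ((a / m) ^ 2 * m / 2) * (Real.exp (a / m * a))⁻¹ := by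
    rw [← Real.exp_neg, ← Real.exp_add]
    congr 1
    field_simp
    ring
  rw [h3, mul_right_comm, ← div_eq_mul_inv, le_div_iff₀ (Real.exp_pos _)]
  exact (h1.trans h).trans (mul_le_mul_of_nonneg_right h2 (by positivity))

end SignFlips

section RandomGraph

variable {n : ℕ}

instance : IsProbabilityMeasure (randomGraphHalf n) := by
  unfold randomGraphHalf; infer_instance

instance : MeasurableSingletonClass (SimpleGraph (Fin n)) where
  measurableSet_singleton G := by
    rw [← SimpleGraph.edgeSet_injective.preimage_image {G}, Set.image_singleton]
    exact SimpleGraph.measurableEmbedding_edgeSet.measurable (measurableSet_singleton _)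

/-- For edge probability `1/2` all graphs are equally likely. -/
theorem randomGraphHalf_singleton (G H : SimpleGraph (Fin n)) :
    (randomGraphHalf n) {G} = (randomGraphHalf n) {H} := by
  classical
  have h : ∀ G : SimpleGraph (Fin n), (randomGraphHalf n) {G} =
      (unitInterval.toNNReal halfProb : ENNReal) ^ ((Nat.card (Fin n)).choose 2) := by
    intro G
    have hs : unitInterval.symm halfProb = halfProb := by
      ext
      simp only [unitInterval.coe_symm_eq, halfProb]
      norm_num
    have hc : G.edgeSet.ncard ≤ (Nat.card (Fin n)).choose 2 := by
      rw [← SimpleGraph.coe_edgeFinset, Set.ncard_coe_finset, Nat.card_eq_fintype_card]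
      exact SimpleGraph.card_edgeFinset_le_card_choose_two
    rw [randomGraphHalf, SimpleGraph.binomialRandom_singleton, hs, ← pow_add,
      Nat.add_sub_cancel' hc]
  rw [h, h]

open Classical in
theorem randomGraphHalf_real (A : Set (SimpleGraph (Fin n))) :
    (randomGraphHalf n).real A * Fintype.card (SimpleGraph (Fin n)) =
      #{G : SimpleGraph (Fin n) | G ∈ A} := by
  have hs : ∀ S : Finset (SimpleGraph (Fin n)), (randomGraphHalf n).real S =
      #S * (randomGraphHalf n).real {⊥} := by
    intro S
    rw [← sum_measureReal_singleton, ← nsmul_eq_mul]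
    refine sum_eq_card_nsmul fun G _ => ?_
    rw [Measure.real, Measure.real, randomGraphHalf_singleton G ⊥]
  have h1 := hs univ
  have h2 := hs {G | G ∈ A}
  rw [coe_univ, probReal_univ, card_univ] at h1
  have : ((univ.filter (· ∈ A) : Finset (SimpleGraph (Fin n))) : Set _) = A := by ext; simp
  rw [this] at h2
  rw [h2, mul_assoc, mul_comm (Measure.real _ _), ← h1, mul_one]

theorem randomGraphHalf_abs_sum_le {ι : Type*} [DecidableEq ι]
    (X : ι → SimpleGraph (Fin n) → ℝ) (σ : ι → Equiv.Perm (SimpleGraph (Fin n)))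
    (hX : ∀ i ω, |X i ω| ≤ 1)
    (s : Finset ι) (hneg : ∀ i ∈ s, ∀ ω, X i (σ i ω) = -X i ω)
    (hfix : ∀ i ∈ s, ∀ j ∈ s, i ≠ j → ∀ ω, X j (σ i ω) = X j ω)
    {a m : ℝ} (ha : 0 ≤ a) (hm : 0 < m) (hs : #s ≤ m) :
    (randomGraphHalf n).real {G | a ≤ |∑ i ∈ s, X i G|} ≤
      2 * Real.exp (-(a ^ 2 / (2 * m))) := by
  classical
  have h1 := card_le_sum_of_flips X σ hX s hneg hfix ha hm hs
  have h2 := card_le_sum_of_flips (fun i ω => -X i ω) σ (fun i ω => by rw [abs_neg]; exact hX i ω)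
    s (fun i hi ω => by rw [hneg i hi]) (fun i hi j hj hij ω => by rw [hfix i hi j hj hij])
    ha hm hs
  have hpos : (0 : ℝ) < Fintype.card (SimpleGraph (Fin n)) := by
    exact_mod_cast Fintype.card_pos
  refine le_of_mul_le_mul_right ?_ hpos
  rw [randomGraphHalf_real]
  have h3 : (#{G : SimpleGraph (Fin n) | G ∈ {G | a ≤ |∑ i ∈ s, X i G|}} : ℝ) ≤
      #{G | a ≤ ∑ i ∈ s, X i G} + #{G | a ≤ ∑ i ∈ s, -X i G} := by
    rw [← Nat.cast_add]
    refine Nat.cast_le.2 ((card_le_card fun G hG => ?_).trans (card_union_le _ _))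
    simp only [Set.mem_ofPred_eq, mem_filter, mem_univ, true_and, mem_union, sum_neg_distrib]
      at hG ⊢
    exact le_abs.1 hG
  linarith

end RandomGraph

section EdgeSigns

variable {V : Type*}

open Classical in
/-- The `±1` adjacency matrix of `G`, with zero diagonal. -/
noncomputable def edgeSign (G : SimpleGraph V) (a b : V) : ℝ :=
  if a = b then 0 else if G.Adj a b then 1 else -1

/-- Switching the pair `{a, b}` between being an edge and being a non-edge. -/
noncomputable def flipEdge (a b : V) : Equiv.Perm (SimpleGraph V) :=
  (symmDiff_left_involutive (SimpleGraph.edge a b)).toPerm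

theorem flipEdge_adj (a b : V) (G : SimpleGraph V) (c d : V) :
    (flipEdge a b G).Adj c d ↔
      (G.Adj c d ∧ ¬ (SimpleGraph.edge a b).Adj c d ∨
        (SimpleGraph.edge a b).Adj c d ∧ ¬ G.Adj c d) := by
  simp [flipEdge, symmDiff]

theorem flipEdge_adj_self {a b : V} (h : a ≠ b) (G : SimpleGraph V) :
    (flipEdge a b G).Adj a b ↔ ¬ G.Adj a b := by
  rw [flipEdge_adj]; simp [SimpleGraph.edge_adj, h]

theorem flipEdge_adj_of_ne {a b c d : V} (h1 : ¬ (c = a ∧ d = b)) (h2 : ¬ (c = b ∧ d = a))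
    (G : SimpleGraph V) : (flipEdge a b G).Adj c d ↔ G.Adj c d := by
  have : ¬ (SimpleGraph.edge a b).Adj c d := by rw [SimpleGraph.edge_adj]; tauto
  rw [flipEdge_adj]; simp [this]

theorem abs_edgeSign_le (G : SimpleGraph V) (a b : V) : |edgeSign G a b| ≤ 1 := by
  unfold edgeSign; split_ifs <;> simp

theorem edgeSign_comm (G : SimpleGraph V) (a b : V) : edgeSign G a b = edgeSign G b a := by
  unfold edgeSign
  classical exact if_congr eq_comm rfl (if_congr (G.adj_comm a b) rfl rfl)

theorem edgeSign_flipEdge_self (G : SimpleGraph V) (a b : V) :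
    edgeSign (flipEdge a b G) a b = -edgeSign G a b := by
  by_cases h : a = b
  · simp [edgeSign, h]
  · unfold edgeSign
    rw [if_neg h, if_neg h]
    by_cases hG : G.Adj a b
    · rw [if_pos hG, if_neg]; rw [flipEdge_adj_self h]; simpa
    · rw [if_neg hG, if_pos (by rwa [flipEdge_adj_self h]), neg_neg]

theorem edgeSign_flipEdge_of_ne {a b c d : V} (h1 : ¬ (c = a ∧ d = b)) (h2 : ¬ (c = b ∧ d = a))
    (G : SimpleGraph V) : edgeSign (flipEdge a b G) c d = edgeSign G c d := by
  unfold edgeSign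
  classical exact if_congr Iff.rfl rfl (if_congr (flipEdge_adj_of_ne h1 h2 G) rfl rfl)

end EdgeSigns

section Tails

variable {n : ℕ}

theorem randomGraphHalf_discrepancy (A B : Finset (Fin n)) :
    (randomGraphHalf n).real
      {G | 3 * √n * √(#A * #B) < |∑ e ∈ A ×ˢ B with e.1 < e.2, edgeSign G e.1 e.2|} ≤
      2 * Real.exp (-(9 / 2 * n)) := by
  by_cases hAB : #A * #B = 0
  · have : ∀ G : SimpleGraph (Fin n),
        ∑ e ∈ A ×ˢ B with e.1 < e.2, edgeSign G e.1 e.2 = 0 := by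
      intro G
      have : A ×ˢ B = ∅ := by rw [← card_eq_zero, card_product]; exact hAB
      simp [this]
    have h0 : ¬ 3 * √(n : ℝ) * √(#A * #B : ℝ) < 0 := not_lt.2 (by positivity)
    simp only [this, abs_zero, h0, Set.ofPred_false, measureReal_empty]
    positivity
  have hm : (0 : ℝ) < (#A * #B : ℕ) := by exact_mod_cast Nat.pos_of_ne_zero hAB
  have h := randomGraphHalf_abs_sum_le (fun e G => edgeSign G e.1 e.2)
    (fun e : Fin n × Fin n => flipEdge e.1 e.2) (fun e G => abs_edgeSign_le G _ _)
    ((A ×ˢ B).filter fun e => e.1 < e.2) (fun e _ G => edgeSign_flipEdge_self G _ _)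
    (fun e he f hf hef G => edgeSign_flipEdge_of_ne (fun h => hef (Prod.ext h.1.symm h.2.symm))
      (fun h => by
        have h1 := (mem_filter.1 he).2
        have h2 := (mem_filter.1 hf).2
        rw [h.1, h.2] at h2
        exact lt_asymm h1 h2) G)
    (a := 3 * √n * √(#A * #B)) (by positivity) hm
    (by rw [← card_product]; exact_mod_cast card_filter_le _ _)
  refine (measureReal_mono (Set.ofPred_subset_ofPred.2 fun G hG => le_of_lt hG)).trans
    (h.trans (le_of_eq ?_))
  rw [mul_pow, mul_pow, Real.sq_sqrt (by positivity), Real.sq_sqrt (by positivity)]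
  push_cast at hm ⊢
  congr 3
  rw [div_eq_iff (by positivity)]
  ring

/-- The signs at `v` are independent of the common neighbourhood of `U`, as `v ∉ U`: switching a pair
`{v, z}` changes the membership of no vertex other than `v`. -/
theorem randomGraphHalf_commonNbrs (hn : 0 < n) (U : Finset (Fin n)) {v : Fin n} (hv : v ∉ U)
    {t : ℝ} (ht : 0 ≤ t) :
    (randomGraphHalf n).real
      {G | t < |∑ z ∈ (commonNbrs G U).erase v, edgeSign G v z|} ≤
      2 * Real.exp (-(t ^ 2 / (2 * n))) := by
  classical
  set X : Fin n → SimpleGraph (Fin n) → ℝ := fun z G =>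
    if z ∈ commonNbrs G U then edgeSign G v z else 0 with hX
  have hsum : ∀ G : SimpleGraph (Fin n), ∑ z ∈ (commonNbrs G U).erase v, edgeSign G v z =
      ∑ z ∈ univ.erase v, X z G := by
    intro G
    rw [hX, ← sum_filter]
    refine sum_congr ?_ fun _ _ => rfl
    ext z; simp
  have hmem : ∀ z w, w ≠ v → ∀ G : SimpleGraph (Fin n),
      (w ∈ commonNbrs (flipEdge v z G) U ↔ w ∈ commonNbrs G U) := by
    intro z w hw G
    rw [mem_commonNbrs, mem_commonNbrs]
    refine forall₂_congr fun u hu => flipEdge_adj_of_ne ?_ ?_ G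
    · rintro ⟨rfl, -⟩; exact hv hu
    · rintro ⟨-, rfl⟩; exact hw rfl
  have h := randomGraphHalf_abs_sum_le X (fun z => flipEdge v z) (fun z G => by
      simp only [hX]; split_ifs; exacts [abs_edgeSign_le _ _ _, by simp]) (univ.erase v)
    (fun z hz G => by
      simp only [hX, hmem z z (ne_of_mem_erase hz) G, edgeSign_flipEdge_self]
      split_ifs <;> simp)
    (fun z hz w hw hzw G => by
      simp only [hX, hmem z w (ne_of_mem_erase hw) G]
      rw [edgeSign_flipEdge_of_ne (fun h => hzw h.2.symm)
        (fun h => ne_of_mem_erase hz h.1.symm)])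
    (a := t) (m := n) ht (by exact_mod_cast hn)
    (by simp)
  simp_rw [hsum]
  exact (measureReal_mono (Set.ofPred_subset_ofPred.2 fun G hG => le_of_lt hG)).trans h

end Tails

/-! ### Operator norm from discrepancy, by binary digits -/

section Digits

variable {V : Type*} [Fintype V]

open Classical in
/-- The points at which the `j`-th binary digit of `m` is `1`. -/
noncomputable def digitSet (m : V → ℕ) (j : ℕ) : Finset V :=
  univ.filter fun a => j ∈ (m a).bitIndices.toFinset

theorem mem_digitSet {m : V → ℕ} {j : ℕ} {a : V} :
    a ∈ digitSet m j ↔ j ∈ (m a).bitIndices.toFinset := by simp [digitSet]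

open Classical in
theorem cast_eq_sum_digitSet {m : V → ℕ} {l : ℕ} (hm : ∀ a, m a < 2 ^ l) (a : V) :
    (m a : ℝ) = ∑ j ∈ range l, 2 ^ j * (if a ∈ digitSet m j then 1 else 0) := by
  have h := sum_toFinset_bitIndices_two_pow (m a)
  have hsub : (m a).bitIndices.toFinset ⊆ range l := by
    intro j hj
    rw [mem_range]
    refine (Nat.pow_lt_pow_iff_right (by norm_num : 1 < 2)).1 (lt_of_le_of_lt ?_ (hm a))
    calc 2 ^ j ≤ ∑ i ∈ (m a).bitIndices.toFinset, 2 ^ i :=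
          single_le_sum (f := fun i => 2 ^ i) (fun _ _ => Nat.zero_le _) hj
      _ = m a := h
  have h' : (m a : ℝ) = ∑ j ∈ (m a).bitIndices.toFinset, (2 : ℝ) ^ j := by exact_mod_cast h.symm
  rw [h']
  simp_rw [mul_ite, mul_one, mul_zero, mem_digitSet]
  rw [← sum_filter, filter_mem_eq_inter, inter_eq_right.2 hsub]

/-- Cauchy-Schwarz over the `l` digits; this is where a logarithmic factor is lost. -/
theorem sum_digitSet_le {m : V → ℕ} {l : ℕ} (hm : ∀ a, m a < 2 ^ l) :
    ∑ j ∈ range l, 2 ^ j * √(#(digitSet m j)) ≤ √l * √(∑ a, (m a : ℝ) ^ 2) := by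
  classical
  have h := Real.sum_mul_le_sqrt_mul_sqrt (range l) (fun _ => 1)
    (fun j => 2 ^ j * √(#(digitSet m j)))
  simp only [one_mul, one_pow, sum_const, card_range, nsmul_eq_mul, mul_one] at h
  refine h.trans (mul_le_mul_of_nonneg_left (Real.sqrt_le_sqrt ?_) (Real.sqrt_nonneg _))
  have h1 : ∀ j, (2 ^ j * √(#(digitSet m j) : ℝ)) ^ 2 =
      ∑ a, (2 ^ j * (if a ∈ digitSet m j then (1 : ℝ) else 0)) ^ 2 := by
    intro j
    rw [mul_pow, Real.sq_sqrt (by positivity)]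
    simp_rw [mul_pow]
    rw [← mul_sum]
    simp
  simp_rw [h1]
  rw [sum_comm]
  refine sum_le_sum fun a _ => ?_
  rw [cast_eq_sum_digitSet hm a]
  rw [sq (∑ j ∈ range l, _), sum_mul]
  refine sum_le_sum fun j hj => ?_
  rw [sq]
  exact mul_le_mul_of_nonneg_left (single_le_sum (f := fun j => 2 ^ j *
    (if a ∈ digitSet m j then (1 : ℝ) else 0)) (fun _ _ => by positivity) hj) (by positivity)

theorem abs_bilin_nat_le {U : V → V → ℝ} {C : ℝ} (hC : 0 ≤ C)
    (hU : ∀ A B : Finset V, |∑ a ∈ A, ∑ b ∈ B, U a b| ≤ C * √(#A * #B))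
    {l : ℕ} {m k : V → ℕ} (hm : ∀ a, m a < 2 ^ l) (hk : ∀ a, k a < 2 ^ l) :
    |∑ a, ∑ b, U a b * m a * k b| ≤
      C * l * √(∑ a, (m a : ℝ) ^ 2) * √(∑ a, (k a : ℝ) ^ 2) := by
  classical
  have h1 : ∑ a, ∑ b, U a b * m a * k b = ∑ i ∈ range l, ∑ j ∈ range l,
      2 ^ i * 2 ^ j * ∑ a ∈ digitSet m i, ∑ b ∈ digitSet k j, U a b := by
    have e : ∀ i j, ∑ a ∈ digitSet m i, ∑ b ∈ digitSet k j, U a b =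
        ∑ a, ∑ b, U a b * (if a ∈ digitSet m i then 1 else 0) *
          (if b ∈ digitSet k j then 1 else 0) := by
      intro i j
      simp [sum_ite_mem, mul_ite]
    have hcomm : ∀ f : V → V → ℕ → ℕ → ℝ,
        ∑ i ∈ range l, ∑ j ∈ range l, ∑ a, ∑ b, f a b i j =
          ∑ a, ∑ b, ∑ i ∈ range l, ∑ j ∈ range l, f a b i j := by
      intro f
      calc _ = ∑ i ∈ range l, ∑ a, ∑ j ∈ range l, ∑ b, f a b i j :=
            sum_congr rfl fun i _ => sum_comm
        _ = ∑ i ∈ range l, ∑ a, ∑ b, ∑ j ∈ range l, f a b i j :=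
            sum_congr rfl fun i _ => sum_congr rfl fun a _ => sum_comm
        _ = ∑ a, ∑ i ∈ range l, ∑ b, ∑ j ∈ range l, f a b i j := sum_comm
        _ = _ := sum_congr rfl fun a _ => sum_comm
    simp_rw [e, mul_sum]
    rw [hcomm]
    refine sum_congr rfl fun a _ => sum_congr rfl fun b _ => ?_
    rw [cast_eq_sum_digitSet hm a, cast_eq_sum_digitSet hk b, mul_assoc, sum_mul_sum, mul_sum]
    refine sum_congr rfl fun i _ => ?_
    rw [mul_sum]
    exact sum_congr rfl fun j _ => by ring
  rw [h1]
  calc _ ≤ ∑ i ∈ range l, ∑ j ∈ range l,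
        2 ^ i * 2 ^ j * (C * √(#(digitSet m i) * #(digitSet k j))) := by
        refine (abs_sum_le_sum_abs _ _).trans (sum_le_sum fun i _ =>
          (abs_sum_le_sum_abs _ _).trans (sum_le_sum fun j _ => ?_))
        rw [abs_mul, abs_of_nonneg (by positivity : (0 : ℝ) ≤ 2 ^ i * 2 ^ j)]
        exact mul_le_mul_of_nonneg_left (hU _ _) (by positivity)
    _ = C * ((∑ i ∈ range l, 2 ^ i * √(#(digitSet m i))) *
          ∑ j ∈ range l, 2 ^ j * √(#(digitSet k j))) := by
        rw [sum_mul_sum, mul_sum]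
        refine sum_congr rfl fun i _ => ?_
        rw [mul_sum]
        refine sum_congr rfl fun j _ => ?_
        rw [Real.sqrt_mul (by positivity)]
        ring
    _ ≤ C * ((√l * √(∑ a, (m a : ℝ) ^ 2)) * (√l * √(∑ a, (k a : ℝ) ^ 2))) := by
        have h1 := sum_digitSet_le hm
        have h2 := sum_digitSet_le hk
        gcongr
    _ = C * (√l * √l) * √(∑ a, (m a : ℝ) ^ 2) * √(∑ a, (k a : ℝ) ^ 2) := by ring
    _ = _ := by rw [Real.mul_self_sqrt (by positivity)]

/-- Rounding a nonnegative vector down to multiples of its norm divided by `2 ^ l`. -/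
theorem exists_nat_approx (l : ℕ) {x : V → ℝ} (hx : ∀ a, 0 ≤ x a) :
    ∃ m : V → ℕ, (∀ a, m a < 2 ^ (l + 1)) ∧
      ∀ a, √(∑ a, x a ^ 2) / 2 ^ l * m a ≤ x a ∧
        x a - √(∑ a, x a ^ 2) / 2 ^ l * m a ≤ √(∑ a, x a ^ 2) / 2 ^ l := by
  set N := √(∑ a, x a ^ 2) with hN
  have hxN : ∀ a, x a ≤ N := fun a => Real.le_sqrt_of_sq_le
    (single_le_sum (f := fun a => x a ^ 2) (fun _ _ => sq_nonneg _) (mem_univ a))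
  rcases (Real.sqrt_nonneg _ : 0 ≤ N).eq_or_lt with h0 | hpos
  · refine ⟨fun _ => 0, fun _ => by positivity, fun a => ?_⟩
    have h1 := hxN a
    have h2 := hx a
    rw [show N = 0 from h0.symm] at h1 ⊢
    simp only [zero_div, Nat.cast_zero, mul_zero, sub_zero]
    exact ⟨h2, h1⟩
  · have hθ : 0 < N / 2 ^ l := by positivity
    refine ⟨fun a => ⌊x a / (N / 2 ^ l)⌋₊, fun a => ?_, fun a => ⟨?_, ?_⟩⟩
    · rw [Nat.floor_lt (div_nonneg (hx a) hθ.le), div_lt_iff₀ hθ]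
      have : N < ((2 ^ (l + 1) : ℕ) : ℝ) * (N / 2 ^ l) := by
        push_cast
        rw [pow_succ]
        field_simp
        linarith
      exact (hxN a).trans_lt this
    · have := Nat.floor_le (div_nonneg (hx a) hθ.le)
      rw [le_div_iff₀ hθ] at this
      linarith
    · have := (Nat.lt_floor_add_one (x a / (N / 2 ^ l))).le
      rw [div_le_iff₀ hθ] at this
      linarith

theorem abs_bilin_le_sum_mul_sum {U : V → V → ℝ} (hU : ∀ a b, |U a b| ≤ 1) (x y : V → ℝ) :
    |∑ a, ∑ b, U a b * x a * y b| ≤ (∑ a, |x a|) * ∑ b, |y b| := by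
  rw [sum_mul_sum]
  refine (abs_sum_le_sum_abs _ _).trans (sum_le_sum fun a _ =>
    (abs_sum_le_sum_abs _ _).trans (sum_le_sum fun b _ => ?_))
  rw [abs_mul, abs_mul]
  gcongr
  exact mul_le_of_le_one_left (abs_nonneg _) (hU a b)

theorem sum_abs_le_sqrt_card (x : V → ℝ) :
    ∑ a, |x a| ≤ √(Fintype.card V) * √(∑ a, x a ^ 2) := by
  have h := Real.sum_mul_le_sqrt_mul_sqrt (univ : Finset V) (fun _ => 1) (fun a => |x a|)
  simpa using h

theorem abs_bilin_nonneg_le {U : V → V → ℝ} {C : ℝ} (hC : 0 ≤ C)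
    (hU : ∀ A B : Finset V, |∑ a ∈ A, ∑ b ∈ B, U a b| ≤ C * √(#A * #B))
    (hU1 : ∀ a b, |U a b| ≤ 1) {l : ℕ} (hl : Fintype.card V ≤ 2 ^ l)
    {x y : V → ℝ} (hx : ∀ a, 0 ≤ x a) (hy : ∀ a, 0 ≤ y a) :
    |∑ a, ∑ b, U a b * x a * y b| ≤
      (C * (l + 1) + 2 * √(Fintype.card V)) * √(∑ a, x a ^ 2) * √(∑ a, y a ^ 2) := by
  obtain ⟨m, hm, hmx⟩ := exists_nat_approx l hx
  obtain ⟨k, hk, hky⟩ := exists_nat_approx l hy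
  set M := √(∑ a, x a ^ 2) with hM
  set N := √(∑ a, y a ^ 2) with hN
  set n := (Fintype.card V : ℝ) with hn
  have hM0 : 0 ≤ M := Real.sqrt_nonneg _
  have hN0 : 0 ≤ N := Real.sqrt_nonneg _
  have hl' : n ≤ 2 ^ l := by rw [hn]; exact_mod_cast hl
  have hrem : ∀ (Q : ℝ) (z : V → ℝ), 0 ≤ Q → (∀ a, |z a| ≤ Q / 2 ^ l) → ∑ a, |z a| ≤ Q := by
    intro Q z hQ hz
    calc ∑ a, |z a| ≤ ∑ _a : V, Q / 2 ^ l := sum_le_sum fun a _ => hz a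
      _ = n * (Q / 2 ^ l) := by simp [hn]
      _ ≤ 2 ^ l * (Q / 2 ^ l) := by gcongr
      _ = Q := by field_simp
  -- rounding both vectors leaves two remainders, for which the trivial bound suffices
  have hsplit : ∑ a, ∑ b, U a b * x a * y b =
      M / 2 ^ l * (N / 2 ^ l) * ∑ a, ∑ b, U a b * m a * k b +
      ∑ a, ∑ b, U a b * (x a - M / 2 ^ l * m a) * y b +
      ∑ a, ∑ b, U a b * (M / 2 ^ l * m a) * (y b - N / 2 ^ l * k b) := by
    simp_rw [mul_sum, ← sum_add_distrib]
    exact sum_congr rfl fun a _ => sum_congr rfl fun b _ => by ring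
  have hscale : ∀ (Q : ℝ) (w : V → ℕ) (z : V → ℝ), 0 ≤ Q → (∀ a, Q * w a ≤ z a) →
      Q * √(∑ a, (w a : ℝ) ^ 2) ≤ √(∑ a, z a ^ 2) := by
    intro Q w z hQ hz
    have e : Q * √(∑ a, (w a : ℝ) ^ 2) = √(Q ^ 2 * ∑ a, (w a : ℝ) ^ 2) := by
      rw [Real.sqrt_mul (sq_nonneg _), Real.sqrt_sq hQ]
    rw [e]
    refine Real.sqrt_le_sqrt ?_
    rw [mul_sum]
    refine sum_le_sum fun a _ => ?_
    rw [← mul_pow]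
    have := hz a
    gcongr
  have h1 : |M / 2 ^ l * (N / 2 ^ l) * ∑ a, ∑ b, U a b * m a * k b| ≤ C * (l + 1) * M * N := by
    rw [abs_mul, abs_of_nonneg (by positivity)]
    refine (mul_le_mul_of_nonneg_left (abs_bilin_nat_le hC hU hm hk) (by positivity)).trans ?_
    have e1 := hscale (M / 2 ^ l) m x (by positivity) fun a => (hmx a).1
    have e2 := hscale (N / 2 ^ l) k y (by positivity) fun a => (hky a).1
    calc _ = C * (l + 1) * (M / 2 ^ l * √(∑ a, (m a : ℝ) ^ 2)) *
          (N / 2 ^ l * √(∑ a, (k a : ℝ) ^ 2)) := by push_cast; ring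
      _ ≤ _ := by gcongr
  have h2 : |∑ a, ∑ b, U a b * (x a - M / 2 ^ l * m a) * y b| ≤ M * (√n * N) := by
    refine (abs_bilin_le_sum_mul_sum hU1 _ _).trans ?_
    refine mul_le_mul (hrem M _ hM0 fun a => ?_) (sum_abs_le_sqrt_card y) (by positivity) hM0
    rw [abs_of_nonneg (by linarith [(hmx a).1])]
    exact (hmx a).2
  have h3 : |∑ a, ∑ b, U a b * (M / 2 ^ l * m a) * (y b - N / 2 ^ l * k b)| ≤ √n * M * N := by
    refine (abs_bilin_le_sum_mul_sum hU1 _ _).trans ?_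
    refine mul_le_mul ?_ (hrem N _ hN0 fun a => ?_) (by positivity) (by positivity)
    · refine le_trans (sum_le_sum fun a _ => ?_) (sum_abs_le_sqrt_card x)
      rw [abs_of_nonneg (by positivity), abs_of_nonneg (hx a)]
      exact (hmx a).1
    · rw [abs_of_nonneg (by linarith [(hky a).1])]
      exact (hky a).2
  rw [hsplit]
  refine (abs_add_le _ _).trans ?_
  have := abs_add_le (M / 2 ^ l * (N / 2 ^ l) * ∑ a, ∑ b, U a b * m a * k b)
    (∑ a, ∑ b, U a b * (x a - M / 2 ^ l * m a) * y b)
  linarith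

/-- Discrepancy controls the operator norm up to a logarithmic factor `l`. -/
theorem bilinBound_of_discrepancy {U : V → V → ℝ} {C : ℝ} (hC : 0 ≤ C)
    (hU : ∀ A B : Finset V, |∑ a ∈ A, ∑ b ∈ B, U a b| ≤ C * √(#A * #B))
    (hU1 : ∀ a b, |U a b| ≤ 1) {l : ℕ} (hl : Fintype.card V ≤ 2 ^ l) :
    BilinBound U (4 * (C * (l + 1) + 2 * √(Fintype.card V))) := by
  intro x y
  set K := C * (l + 1) + 2 * √(Fintype.card V) with hK
  have hK0 : 0 ≤ K := by positivity
  have hle : ∀ z w : V → ℝ, (∀ a, 0 ≤ w a) → (∀ a, w a ≤ |z a|) →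
      √(∑ a, w a ^ 2) ≤ √(∑ a, z a ^ 2) := fun z w h0 h =>
    Real.sqrt_le_sqrt (sum_le_sum fun a _ => by
      rw [← sq_abs (z a)]
      exact pow_le_pow_left₀ (h0 a) (h a) 2)
  have hp : ∀ t : ℝ, t⁺ ≤ |t| := fun t => by
    rw [← posPart_add_negPart]; linarith [negPart_nonneg t]
  have hq : ∀ t : ℝ, t⁻ ≤ |t| := fun t => by
    rw [← posPart_add_negPart]; linarith [posPart_nonneg t]
  have key : ∀ u v : V → ℝ, (∀ a, 0 ≤ u a) → (∀ a, u a ≤ |x a|) → (∀ a, 0 ≤ v a) →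
      (∀ a, v a ≤ |y a|) → |∑ a, ∑ b, U a b * u a * v b| ≤
        K * √(∑ a, x a ^ 2) * √(∑ a, y a ^ 2) := by
    intro u v hu hux hv hvy
    refine (abs_bilin_nonneg_le hC hU hU1 hl hu hv).trans ?_
    have h1 := hle x u hu hux
    have h2 := hle y v hv hvy
    gcongr
  have hsplit : ∑ a, ∑ b, U a b * x a * y b =
      ∑ a, ∑ b, U a b * (x a)⁺ * (y b)⁺ - ∑ a, ∑ b, U a b * (x a)⁺ * (y b)⁻ -
      ∑ a, ∑ b, U a b * (x a)⁻ * (y b)⁺ + ∑ a, ∑ b, U a b * (x a)⁻ * (y b)⁻ := by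
    simp_rw [← sum_sub_distrib, ← sum_add_distrib]
    refine sum_congr rfl fun a _ => sum_congr rfl fun b _ => ?_
    conv_lhs => rw [← posPart_sub_negPart (x a), ← posPart_sub_negPart (y b)]
    ring
  have k1 := abs_le.1 (key (fun a => (x a)⁺) (fun a => (y a)⁺) (fun _ => posPart_nonneg _)
    (fun _ => hp _) (fun _ => posPart_nonneg _) (fun _ => hp _))
  have k2 := abs_le.1 (key (fun a => (x a)⁺) (fun a => (y a)⁻) (fun _ => posPart_nonneg _)
    (fun _ => hp _) (fun _ => negPart_nonneg _) (fun _ => hq _))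
  have k3 := abs_le.1 (key (fun a => (x a)⁻) (fun a => (y a)⁺) (fun _ => negPart_nonneg _)
    (fun _ => hq _) (fun _ => posPart_nonneg _) (fun _ => hp _))
  have k4 := abs_le.1 (key (fun a => (x a)⁻) (fun a => (y a)⁻) (fun _ => negPart_nonneg _)
    (fun _ => hq _) (fun _ => negPart_nonneg _) (fun _ => hq _))
  rw [hsplit, abs_le]
  constructor <;> linarith [k1.1, k1.2, k2.1, k2.2, k3.1, k3.2, k4.1, k4.2]

end Digits

/-! ### Pseudorandom graphs -/

section Pseudorandom

variable {V : Type*} [LinearOrder V]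

theorem adjInd_sub (G : SimpleGraph V) (a b : V) :
    (adjInd G a b - if a = b then 0 else 1 / 2) = edgeSign G a b / 2 := by
  unfold adjInd edgeSign
  by_cases h : a = b
  · subst h; simp
  · by_cases hG : G.Adj a b
    · simp [h, hG]; norm_num
    · simp [h, hG]; norm_num

variable [Fintype V]

/-- Discrepancy bound for all pairs of vertex sets. Only the pairs `a < b` are counted, so that
each edge enters once. -/
def HasDiscrepancy (G : SimpleGraph V) (C : ℝ) : Prop :=
  ∀ A B : Finset V, |∑ e ∈ A ×ˢ B with e.1 < e.2, edgeSign G e.1 e.2| ≤ C * √(#A * #B)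

/-- Every vertex `v` splits the common neighbourhood of every set of fewer than `m` other vertices
into nearly equal halves. -/
def SplitsCommonNbrs (G : SimpleGraph V) (m : ℕ) (t : ℝ) : Prop :=
  ∀ U : Finset V, #U < m → ∀ v ∉ U, |∑ z ∈ (commonNbrs G U).erase v, edgeSign G v z| ≤ t

/-- The upper and the lower triangle of the sign matrix are treated separately; one is the transpose of
the other. -/
theorem bilinBound_adjInd_sub {G : SimpleGraph V} {C : ℝ} (hC : 0 ≤ C)
    (hG : HasDiscrepancy G C) {l : ℕ} (hl : Fintype.card V ≤ 2 ^ l) :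
    BilinBound (fun a b => adjInd G a b - if a = b then 0 else 1 / 2)
      (4 * (C * (l + 1) + 2 * √(Fintype.card V))) := by
  set U : V → V → ℝ := fun a b => if a < b then edgeSign G a b else 0 with hU
  have hUd : ∀ A B : Finset V, |∑ a ∈ A, ∑ b ∈ B, U a b| ≤ C * √(#A * #B) := by
    intro A B
    have := hG A B
    rwa [sum_filter, sum_product] at this
  have hU1 : ∀ a b, |U a b| ≤ 1 := fun a b => by
    simp only [hU]; split_ifs
    exacts [abs_edgeSign_le _ _ _, by simp]
  have hb := bilinBound_of_discrepancy hC hUd hU1 hl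
  intro x y
  simp_rw [adjInd_sub]
  have hsplit : ∑ a, ∑ b, edgeSign G a b / 2 * x a * y b =
      (∑ a, ∑ b, U a b * x a * y b + ∑ b, ∑ a, U b a * y b * x a) / 2 := by
    rw [sum_comm (f := fun b a => U b a * y b * x a), ← sum_add_distrib, sum_div]
    refine sum_congr rfl fun a _ => ?_
    rw [← sum_add_distrib, sum_div]
    refine sum_congr rfl fun b _ => ?_
    have : edgeSign G a b = U a b + U b a := by
      simp only [hU]
      rcases lt_trichotomy a b with h | h | h
      · simp [h, h.not_gt]
      · subst h; simp [edgeSign]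
      · simp [h, h.not_gt, edgeSign_comm G a b]
    rw [this]; ring
  rw [hsplit, abs_div, abs_two]
  have h1 := hb x y
  have h2 := hb y x
  have h3 := abs_add_le (∑ a, ∑ b, U a b * x a * y b) (∑ b, ∑ a, U b a * y b * x a)
  linarith

theorem card_commonNbrs_insert (G : SimpleGraph V) (U : Finset V) (v : V) :
    (#(commonNbrs G (insert v U)) : ℝ) =
      (#((commonNbrs G U).erase v) + ∑ z ∈ (commonNbrs G U).erase v, edgeSign G v z) / 2 := by
  classical
  have h : commonNbrs G (insert v U) = ((commonNbrs G U).erase v).filter (G.Adj v ·) := by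
    ext z
    simp only [mem_commonNbrs, mem_insert, forall_eq_or_imp, mem_filter, mem_erase, ne_eq]
    constructor
    · rintro ⟨h1, h2⟩; exact ⟨⟨h1.ne', h2⟩, h1⟩
    · rintro ⟨⟨_, h2⟩, h1⟩; exact ⟨h1, h2⟩
  rw [h, card_eq_sum_ones, card_eq_sum_ones ((commonNbrs G U).erase v), Nat.cast_sum, Nat.cast_sum,
    sum_filter, ← sum_add_distrib, sum_div]
  refine sum_congr rfl fun z hz => ?_
  have : v ≠ z := (ne_of_mem_erase hz).symm
  unfold edgeSign
  by_cases hG : G.Adj v z <;> simp [this, hG]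

/-- Adding a vertex to `U` halves the number of common neighbours up to an error of `(t + 1) / 2`, and
halves the previous error, so that the errors do not accumulate. -/
theorem abs_card_commonNbrs_sub_le {G : SimpleGraph V} {m : ℕ} {t : ℝ} (ht : 0 ≤ t)
    (hG : SplitsCommonNbrs G m t) (U : Finset V) : #U < m →
    |(#(commonNbrs G U) : ℝ) - Fintype.card V / 2 ^ #U| ≤ t + 1 := by
  induction U using Finset.induction_on with
  | empty =>
    intro _
    have : commonNbrs G ∅ = univ := by ext; simp [mem_commonNbrs]
    simp [this]
    linarith
  | insert v U hv ih =>
    intro hU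
    rw [card_insert_of_notMem hv] at hU ⊢
    have h1 := abs_le.1 (ih (by omega))
    have h2 := abs_le.1 (hG U (by omega) v hv)
    have h3 : (#((commonNbrs G U).erase v) : ℝ) ≤ #(commonNbrs G U) := by
      exact_mod_cast card_le_card (erase_subset _ _)
    have h4 : (#(commonNbrs G U) : ℝ) - 1 ≤ #((commonNbrs G U).erase v) := by
      have := pred_card_le_card_erase (s := commonNbrs G U) (a := v)
      have : #(commonNbrs G U) ≤ #((commonNbrs G U).erase v) + 1 := by omega
      rw [sub_le_iff_le_add]
      exact_mod_cast this
    rw [card_commonNbrs_insert, pow_succ, ← div_div, abs_le]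
    constructor <;> linarith [h1.1, h1.2, h2.1, h2.2]

end Pseudorandom

/-- Union bound over the `4 ^ n` pairs of vertex sets and over the pairs `(U, v)`, of which there are at
most `2 * r * n ^ (2 * r) ≤ exp (2 * log n ^ 2)`. -/
theorem randomGraphHalf_pseudorandom {n r : ℕ} (hn : 1 ≤ Real.log n) (hr1 : 1 ≤ r)
    (hr : 2 * (r : ℝ) ≤ Real.log n) :
    1 - (2 * Real.exp (-n) + 2 / n) ≤ (randomGraphHalf n).real
      {G | HasDiscrepancy G (3 * √n) ∧ SplitsCommonNbrs G (2 * r) (3 * √n * Real.log n)} := by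
  classical
  set μ := randomGraphHalf n with hμ
  have hn0 : 0 < n := by
    rcases Nat.eq_zero_or_pos n with h | h
    · rw [h] at hn; norm_num at hn
    · exact h
  have hnR : (0 : ℝ) < n := by exact_mod_cast hn0
  set ℓ := Real.log n with hℓ
  set D : Finset (Fin n) × Finset (Fin n) → Set (SimpleGraph (Fin n)) := fun p =>
    {G | 3 * √n * √(#p.1 * #p.2) < |∑ e ∈ p.1 ×ˢ p.2 with e.1 < e.2, edgeSign G e.1 e.2|} with hD
  set T : Finset (Finset (Fin n) × Fin n) :=
    ((univ.filter fun U : Finset (Fin n) => #U < 2 * r) ×ˢ univ).filter fun p => p.2 ∉ p.1 with hT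
  set S : Finset (Fin n) × Fin n → Set (SimpleGraph (Fin n)) := fun p =>
    {G | 3 * √n * ℓ < |∑ z ∈ (commonNbrs G p.1).erase p.2, edgeSign G p.2 z|} with hS
  have hDbound : μ.real (⋃ p ∈ (univ : Finset (Finset (Fin n) × Finset (Fin n))), D p) ≤
      2 * Real.exp (-n) := by
    refine (measureReal_biUnion_finset_le _ _).trans ?_
    refine (sum_le_card_nsmul _ _ _ fun p _ => randomGraphHalf_discrepancy p.1 p.2).trans ?_
    rw [nsmul_eq_mul, card_univ, Fintype.card_prod, Fintype.card_finset, Fintype.card_fin]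
    have h2 : (2 : ℝ) ≤ Real.exp 1 := by linarith [Real.add_one_le_exp (1 : ℝ)]
    have h3 : ((2 ^ n * 2 ^ n : ℕ) : ℝ) ≤ Real.exp (2 * n) := by
      push_cast
      calc (2 : ℝ) ^ n * 2 ^ n ≤ Real.exp 1 ^ n * Real.exp 1 ^ n := by gcongr
        _ = Real.exp (2 * n) := by
          rw [← Real.exp_nat_mul, ← Real.exp_add]; congr 1; ring
    calc _ ≤ Real.exp (2 * n) * (2 * Real.exp (-(9 / 2 * n))) := by gcongr
      _ = 2 * Real.exp (2 * n + -(9 / 2 * n)) := by rw [Real.exp_add]; ring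
      _ ≤ 2 * Real.exp (-n) := by gcongr; linarith
  have hcard : (#T : ℝ) ≤ Real.exp (2 * ℓ ^ 2) := by
    have h1 : #T ≤ #(univ.filter fun U : Finset (Fin n) => #U < 2 * r) * n :=
      (card_filter_le _ _).trans (by rw [card_product, card_univ, Fintype.card_fin])
    have h2 : #(univ.filter fun U : Finset (Fin n) => #U < 2 * r) ≤ 2 * r * n ^ (2 * r - 1) := by
      have : (univ.filter fun U : Finset (Fin n) => #U < 2 * r) ⊆
          (range (2 * r)).biUnion fun j => powersetCard j univ := by
        intro U hU
        simpa [mem_powersetCard] using hU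
      refine (card_le_card this).trans (card_biUnion_le.trans ?_)
      refine (sum_le_card_nsmul _ _ (n ^ (2 * r - 1)) fun j hj => ?_).trans (by simp)
      rw [card_powersetCard, card_univ, Fintype.card_fin]
      refine (Nat.choose_le_pow n j).trans (Nat.pow_le_pow_right hn0 ?_)
      rw [mem_range] at hj; omega
    have h3 : #T ≤ 2 * r * n ^ (2 * r) := by
      refine h1.trans ((Nat.mul_le_mul_right n h2).trans (le_of_eq ?_))
      obtain ⟨j, hj⟩ : ∃ j, 2 * r = j + 1 := ⟨2 * r - 1, by omega⟩
      rw [mul_assoc, ← pow_succ]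
      congr 2
      omega
    have h4 : (2 * r : ℝ) ≤ Real.exp ℓ := by linarith [Real.add_one_le_exp ℓ]
    have h5 : (n : ℝ) ^ (2 * r) ≤ Real.exp (ℓ * ℓ) := by
      rw [← Real.exp_log hnR, ← Real.exp_nat_mul]
      push_cast
      rw [← hℓ]
      gcongr
    calc (#T : ℝ) ≤ 2 * r * n ^ (2 * r) := by exact_mod_cast h3
      _ ≤ Real.exp ℓ * Real.exp (ℓ * ℓ) := by gcongr
      _ = Real.exp (ℓ + ℓ * ℓ) := by rw [Real.exp_add]
      _ ≤ _ := by gcongr; nlinarith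
  have hSbound : μ.real (⋃ p ∈ T, S p) ≤ 2 / n := by
    refine (measureReal_biUnion_finset_le _ _).trans ?_
    refine (sum_le_card_nsmul _ _ _ fun p hp => randomGraphHalf_commonNbrs hn0 p.1
      (mem_filter.1 hp).2 (t := 3 * √n * ℓ) (by positivity)).trans ?_
    rw [nsmul_eq_mul, mul_pow, mul_pow, Real.sq_sqrt hnR.le]
    have e : 3 ^ 2 * (n : ℝ) * ℓ ^ 2 / (2 * n) = 9 / 2 * ℓ ^ 2 := by field_simp; norm_num
    rw [e]
    calc _ ≤ Real.exp (2 * ℓ ^ 2) * (2 * Real.exp (-(9 / 2 * ℓ ^ 2))) := by gcongr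
      _ = 2 * Real.exp (2 * ℓ ^ 2 + -(9 / 2 * ℓ ^ 2)) := by rw [Real.exp_add]; ring
      _ ≤ 2 * Real.exp (-ℓ) := by gcongr; nlinarith
      _ = 2 / n := by rw [Real.exp_neg, hℓ, Real.exp_log hnR]; rfl
  have hsub : {G | HasDiscrepancy G (3 * √n) ∧ SplitsCommonNbrs G (2 * r) (3 * √n * ℓ)}ᶜ ⊆
      (⋃ p ∈ (univ : Finset (Finset (Fin n) × Finset (Fin n))), D p) ∪ ⋃ p ∈ T, S p := by
    intro G hG
    by_contra hcon
    apply hG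
    simp only [Set.mem_union, Set.mem_iUnion, not_or, not_exists, mem_univ, hD, hS, hT,
      Set.mem_ofPred_eq, not_lt, mem_filter, mem_product, true_and, and_true] at hcon
    exact ⟨fun A B => hcon.1 (A, B) trivial, fun U hU v hv => hcon.2 (U, v) ⟨hU, hv⟩⟩
  have hmeas := (measureReal_mono (μ := μ) hsub).trans (measureReal_union_le _ _)
  have hcompl := probReal_compl_eq_one_sub (μ := μ)
    (s := {G | HasDiscrepancy G (3 * √n) ∧ SplitsCommonNbrs G (2 * r) (3 * √n * ℓ)})
    (Set.toFinite _).measurableSet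
  linarith

/-! ### Positivity of the quadratic form -/

/-- The coefficient of `cliqueMatrix G r k` at a pair with union of size `m`. -/
noncomputable def cliqueWeight (r k m : ℕ) : ℝ := (k.choose m : ℝ) / ((2 * r).choose m : ℝ)

/-- The entry of the main part of the matrix at a pair of `r`-sets meeting in `j` points. -/
noncomputable def mainEntry (n r k j : ℕ) : ℝ :=
  cliqueWeight r k (2 * r - j) * (cliqueMainTerm n j (2 * r - j) * (1 / 2) ^ ((r - j) ^ 2))

section Weights

theorem cliqueWeight_nonneg (r k m : ℕ) : 0 ≤ cliqueWeight r k m := by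
  unfold cliqueWeight; positivity

theorem cliqueWeight_le {r k m : ℕ} (hk : 1 ≤ k) (hm : m ≤ 2 * r) :
    cliqueWeight r k m ≤ (k : ℝ) ^ (2 * r) := by
  unfold cliqueWeight
  have h1 : (1 : ℝ) ≤ ((2 * r).choose m : ℝ) := by exact_mod_cast Nat.choose_pos hm
  refine (div_le_self (by positivity) h1).trans ?_
  have h2 : k.choose m ≤ k ^ (2 * r) :=
    (Nat.choose_le_pow k m).trans (Nat.pow_le_pow_right hk hm)
  exact_mod_cast h2

theorem cliqueWeight_succ_le {r j m : ℕ} (k : ℕ) (hm : m + 1 + j = 2 * r) :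
    (j + 1) * cliqueWeight r k (m + 1) ≤ k * cliqueWeight r k m := by
  unfold cliqueWeight
  have h1 : (k.choose (m + 1) : ℝ) * (m + 1) = k.choose m * (k - m : ℕ) := by
    exact_mod_cast Nat.choose_succ_right_eq k m
  have h2 : ((2 * r).choose (m + 1) : ℝ) * (m + 1) = (2 * r).choose m * (j + 1) := by
    have := Nat.choose_succ_right_eq (2 * r) m
    rw [show 2 * r - m = j + 1 by omega] at this
    exact_mod_cast this
  have p1 : (0 : ℝ) < (2 * r).choose (m + 1) := by exact_mod_cast Nat.choose_pos (by omega)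
  have p2 : (0 : ℝ) < (2 * r).choose m := by exact_mod_cast Nat.choose_pos (by omega)
  have h3 : ((k - m : ℕ) : ℝ) ≤ k := by exact_mod_cast Nat.sub_le k m
  have h4 : (j + 1) * ((k.choose (m + 1) : ℝ) / (2 * r).choose (m + 1)) =
      (k - m : ℕ) * ((k.choose m : ℝ) / (2 * r).choose m) := by
    rw [← mul_div_assoc, ← mul_div_assoc, div_eq_div_iff p1.ne' p2.ne']
    have p3 : (m + 1 : ℝ) ≠ 0 := by positivity
    refine mul_right_cancel₀ p3 ?_
    calc _ = (k.choose (m + 1) * (m + 1) : ℝ) * ((2 * r).choose m * (j + 1)) := by ring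
      _ = _ := by rw [h1, ← h2]; ring
  rw [h4]
  gcongr

theorem mainEntry_nonneg (n r k j : ℕ) : 0 ≤ mainEntry n r k j :=
  mul_nonneg (cliqueWeight_nonneg _ _ _) (mul_nonneg (cliqueMainTerm_nonneg _ _ _) (by positivity))

/-- The number of edges required in total, `j * (2 * r - j) + j.choose 2 + (r - j) ^ 2`, is
`r ^ 2 + j.choose 2`. -/
theorem mainEntry_eq {r j : ℕ} (n k : ℕ) (hj : j ≤ r) : mainEntry n r k j =
    cliqueWeight r k (2 * r - j) * ((n : ℝ) ^ j / j.factorial / 2 ^ (r ^ 2 + j.choose 2)) := by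
  obtain ⟨s, rfl⟩ := Nat.exists_eq_add_of_le hj
  have e : (j + s) ^ 2 + j.choose 2 = j * (2 * (j + s) - j) + j.choose 2 + s ^ 2 := by
    rw [show 2 * (j + s) - j = j + 2 * s by omega]; ring
  unfold mainEntry cliqueMainTerm
  rw [e, Nat.add_sub_cancel_left, pow_add 2 (j * _ + _), one_div, inv_pow, ← div_eq_mul_inv,
    div_div]

/-- Up to powers of two, consecutive entries have ratio at least `n / k`. -/
theorem mainEntry_growth {n r k : ℕ} (hn : 2 ^ (2 * r) * k ≤ n) {j : ℕ} (hj : j < r) :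
    2 ^ (r + 1) * mainEntry n r k j ≤ mainEntry n r k (j + 1) := by
  rw [mainEntry_eq n k hj.le, mainEntry_eq n k hj]
  obtain ⟨m, hm⟩ : ∃ m, m + 1 + j = 2 * r := ⟨2 * r - j - 1, by omega⟩
  rw [show 2 * r - j = m + 1 by omega, show 2 * r - (j + 1) = m by omega,
    Nat.choose_succ_succ' j 1, Nat.choose_one_right, Nat.factorial_succ,
    show r ^ 2 + (j + j.choose 2) = r ^ 2 + j.choose 2 + j by ring, pow_add 2 (r ^ 2 + _) j]
  set P : ℝ := 2 ^ (r ^ 2 + j.choose 2)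
  have hP : 0 < P := by positivity
  have hf : (0 : ℝ) < j.factorial := by exact_mod_cast j.factorial_pos
  have hw := cliqueWeight_succ_le k hm
  have hw0 := cliqueWeight_nonneg r k m
  have hw1 := cliqueWeight_nonneg r k (m + 1)
  have hn' : (2 : ℝ) ^ (2 * r) * k ≤ n := by exact_mod_cast hn
  have h2 : (2 : ℝ) ^ (r + 1) * 2 ^ j ≤ 2 ^ (2 * r) := by
    rw [← pow_add]
    exact pow_le_pow_right₀ (by norm_num) (by omega)
  have key : (2 : ℝ) ^ (r + 1) * 2 ^ j * ((j + 1) * cliqueWeight r k (m + 1)) ≤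
      n * cliqueWeight r k m := by
    calc _ ≤ (2 : ℝ) ^ (2 * r) * (k * cliqueWeight r k m) := by gcongr
      _ = 2 ^ (2 * r) * k * cliqueWeight r k m := by ring
      _ ≤ _ := by gcongr
  push_cast
  have e1 : 2 ^ (r + 1) * (cliqueWeight r k (m + 1) * ((n : ℝ) ^ j / j.factorial / P)) =
      (2 : ℝ) ^ (r + 1) * 2 ^ j * ((j + 1) * cliqueWeight r k (m + 1)) *
        ((n : ℝ) ^ j / (j.factorial * P * 2 ^ j * (j + 1))) := by
    field_simp
  have e2 : cliqueWeight r k m * ((n : ℝ) ^ (j + 1) / ((j + 1) * j.factorial) / (P * 2 ^ j)) =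
      n * cliqueWeight r k m * ((n : ℝ) ^ j / (j.factorial * P * 2 ^ j * (j + 1))) := by
    rw [pow_succ]
    field_simp
  rw [e1, e2]
  gcongr

theorem pow_le_choose_mul {k r : ℕ} (hr : 1 ≤ r) (hk : r ≤ k) :
    k ^ r ≤ r ^ (2 * r) * k.choose r := by
  have h1 : k ≤ r * (k + 1 - r) := by
    obtain ⟨d, rfl⟩ := Nat.exists_eq_add_of_le hk
    rw [show r + d + 1 - r = d + 1 by omega]
    nlinarith
  have h2 : (k + 1 - r) ^ r ≤ r.factorial * k.choose r := by
    have := Nat.pow_sub_le_descFactorial k r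
    rwa [Nat.descFactorial_eq_factorial_mul_choose] at this
  calc k ^ r ≤ (r * (k + 1 - r)) ^ r := Nat.pow_le_pow_left h1 r
    _ = r ^ r * (k + 1 - r) ^ r := mul_pow _ _ _
    _ ≤ r ^ r * (r ^ r * k.choose r) :=
        Nat.mul_le_mul_left _ (h2.trans (Nat.mul_le_mul_right _ (Nat.factorial_le_pow r)))
    _ = _ := by rw [two_mul, pow_add]; ring

theorem le_mainEntry_self {n r k : ℕ} (hr : 1 ≤ r) (hk : r ≤ k) :
    (k : ℝ) ^ r * n ^ r ≤ 2 ^ (7 * r ^ 2) * mainEntry n r k r := by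
  rw [mainEntry_eq n k le_rfl, show 2 * r - r = r by omega]
  unfold cliqueWeight
  have hc : (0 : ℝ) < (2 * r).choose r := by exact_mod_cast Nat.choose_pos (by omega)
  have hf : (0 : ℝ) < r.factorial := by exact_mod_cast r.factorial_pos
  have h1 : (k : ℝ) ^ r ≤ r ^ (2 * r) * k.choose r := by exact_mod_cast pow_le_choose_mul hr hk
  have h2 : (r : ℝ) ≤ 2 ^ r := by exact_mod_cast (Nat.lt_two_pow_self (n := r)).le
  have h3 : (r.factorial : ℝ) ≤ r ^ r := by exact_mod_cast Nat.factorial_le_pow r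
  have h4 : ((2 * r).choose r : ℝ) ≤ 2 ^ (2 * r) := by exact_mod_cast Nat.choose_le_two_pow _ _
  have h5 : r.choose 2 ≤ r ^ 2 := Nat.choose_le_pow r 2
  have hr2 : r ≤ r ^ 2 := by nlinarith
  have key : (r : ℝ) ^ (2 * r) * ((2 * r).choose r * r.factorial * 2 ^ (r ^ 2 + r.choose 2)) ≤
      2 ^ (7 * r ^ 2) := by
    calc _ ≤ ((2 : ℝ) ^ r) ^ (2 * r) * (2 ^ (2 * r) * (2 ^ r) ^ r * 2 ^ (r ^ 2 + r ^ 2)) := by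
          have : (r : ℝ) ^ r ≤ (2 ^ r) ^ r := by gcongr
          gcongr
          · exact h3.trans this
          · norm_num
      _ = 2 ^ (2 * r + 5 * r ^ 2) := by
          rw [← pow_mul, ← pow_mul, ← pow_add, ← pow_add, ← pow_add]; congr 1; ring
      _ ≤ _ := pow_le_pow_right₀ (by norm_num) (by omega)
  set P : ℝ := 2 ^ (r ^ 2 + r.choose 2)
  have hP : 0 < P := by positivity
  have e : (2 : ℝ) ^ (7 * r ^ 2) * (k.choose r / (2 * r).choose r * (n ^ r / r.factorial / P)) =
      2 ^ (7 * r ^ 2) * (k.choose r * n ^ r) / ((2 * r).choose r * r.factorial * P) := by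
    field_simp
  rw [e, le_div_iff₀ (by positivity)]
  calc _ ≤ (r : ℝ) ^ (2 * r) * k.choose r * n ^ r * ((2 * r).choose r * r.factorial * P) := by
        gcongr
    _ = (r : ℝ) ^ (2 * r) * ((2 * r).choose r * r.factorial * P) * (k.choose r * n ^ r) := by ring
    _ ≤ _ := by gcongr

end Weights

section QuadraticForm

variable {V : Type*} [Fintype V] [LinearOrder V]

theorem card_filter_card_inter_le {r i : ℕ} (hi : i ≤ r) {I : Finset V} (hI : #I = r) :
    #{J ∈ powersetCard r (univ : Finset V) | #(I ∩ J) = i} ≤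
      r.choose i * Fintype.card V ^ (r - i) := by
  have hsub : (powersetCard r (univ : Finset V)).filter (fun J => #(I ∩ J) = i) ⊆
      (powersetCard i I ×ˢ powersetCard (r - i) univ).image fun p => p.1 ∪ p.2 := by
    intro J hJ
    simp only [mem_filter, mem_powersetCard, subset_univ, true_and] at hJ
    refine mem_image.2 ⟨(I ∩ J, J \ I), mem_product.2 ⟨mem_powersetCard.2 ⟨inter_subset_left, hJ.2⟩,
      mem_powersetCard.2 ⟨subset_univ _, ?_⟩⟩, ?_⟩
    · have := card_inter_add_card_sdiff J I
      rw [inter_comm] at this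
      change #(J \ I) = r - i
      omega
    · ext v
      simp only [mem_union, mem_inter, mem_sdiff]
      tauto
  refine (card_le_card hsub).trans (card_image_le.trans ?_)
  rw [card_product, card_powersetCard, card_powersetCard, hI, card_univ]
  exact Nat.mul_le_mul_left _ (Nat.choose_le_pow _ _)

theorem sum_eq_sum_card_inter {r : ℕ} (g : Finset V → Finset V → ℝ) :
    ∑ I ∈ powersetCard r (univ : Finset V), ∑ J ∈ powersetCard r univ, g I J =
      ∑ i ∈ range (r + 1), ∑ I ∈ powersetCard r (univ : Finset V), ∑ J ∈ powersetCard r univ,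
        if #(I ∩ J) = i then g I J else 0 := by
  symm
  rw [sum_comm]
  refine sum_congr rfl fun I hI => ?_
  rw [sum_comm]
  refine sum_congr rfl fun J _ => ?_
  rw [sum_ite_eq, if_pos]
  rw [mem_range, Nat.lt_succ_iff, ← (mem_powersetCard.1 hI).2]
  exact card_le_card inter_subset_left

/-- Schur test for a kernel on `r`-sets dominated by a function of the intersection size. -/
theorem abs_sum_card_inter_eq_le_of_abs_le {r i : ℕ} (hi : i ≤ r) {φ : ℝ} (hφ : 0 ≤ φ)
    {g : Finset V → Finset V → ℝ}
    (hg : ∀ I J : Finset V, #I = r → #J = r → #(I ∩ J) = i → |g I J| ≤ φ) (x : Finset V → ℝ) :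
    |∑ I ∈ powersetCard r (univ : Finset V), ∑ J ∈ powersetCard r univ,
        if #(I ∩ J) = i then x I * x J * g I J else 0| ≤
      φ * (r.choose i * Fintype.card V ^ (r - i)) * ∑ I ∈ powersetCard r univ, x I ^ 2 := by
  set S := powersetCard r (univ : Finset V) with hS
  have h1 : |∑ I ∈ S, ∑ J ∈ S, if #(I ∩ J) = i then x I * x J * g I J else 0| ≤
      ∑ I ∈ S, ∑ J ∈ S, ((if #(I ∩ J) = i then φ * x I ^ 2 / 2 else 0) +
        (if #(J ∩ I) = i then φ * x J ^ 2 / 2 else 0)) := by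
    refine (abs_sum_le_sum_abs _ _).trans (sum_le_sum fun I hI =>
      (abs_sum_le_sum_abs _ _).trans (sum_le_sum fun J hJ => ?_))
    rw [inter_comm J I]
    split_ifs with h
    · have hb := hg I J (mem_powersetCard.1 hI).2 (mem_powersetCard.1 hJ).2 h
      rw [abs_mul, abs_mul]
      have h2 : |x I| * |x J| * |g I J| ≤ |x I| * |x J| * φ := by gcongr
      have h3 : |x I| * |x J| ≤ x I ^ 2 / 2 + x J ^ 2 / 2 := by
        rw [← sq_abs (x I), ← sq_abs (x J)]
        nlinarith [sq_nonneg (|x I| - |x J|)]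
      nlinarith
    · simp
  have h2 : ∀ I ∈ S, ∑ J ∈ S, (if #(I ∩ J) = i then φ * x I ^ 2 / 2 else 0) ≤
      φ * (r.choose i * Fintype.card V ^ (r - i)) * (x I ^ 2 / 2) := by
    intro I hI
    rw [← sum_filter, sum_const, nsmul_eq_mul]
    have h : (#{J ∈ S | #(I ∩ J) = i} : ℝ) ≤ r.choose i * Fintype.card V ^ (r - i) := by
      exact_mod_cast card_filter_card_inter_le hi (mem_powersetCard.1 hI).2
    calc _ ≤ (r.choose i * Fintype.card V ^ (r - i) : ℝ) * (φ * x I ^ 2 / 2) := by gcongr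
      _ = _ := by ring
  refine h1.trans ?_
  simp_rw [sum_add_distrib]
  rw [sum_comm (f := fun I J => if #(J ∩ I) = i then φ * x J ^ 2 / 2 else 0)]
  have h3 := sum_le_sum h2
  rw [← mul_sum, ← sum_div] at h3
  linarith

/-- The form of the matrix whose `(I, J)` entry ignores the edges inside `I` and inside `J`. It is
the form with entries `mainEntry` plus the errors from the pairs between `I \ J` and `J \ I` and from the
number of clique extensions. Both errors have norm at most about `k ^ (2 * r) * n ^ (r - 1) * L`, against
a smallest eigenvalue of about `k ^ r * n ^ r`. -/
theorem cliqueForm_nonneg {G : SimpleGraph V} {r k : ℕ} {L : ℝ} (hr : 1 ≤ r) (hk : r ≤ k)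
    (hL : 0 ≤ L) (hW : BilinBound (fun a b => adjInd G a b - if a = b then 0 else 1 / 2) L)
    (hN : ∀ U : Finset V, #U < 2 * r → |(#(commonNbrs G U) : ℝ) - Fintype.card V / 2 ^ #U| ≤ L)
    (hgrow : 2 ^ (2 * r) * k ≤ Fintype.card V)
    (hbig : 2 ^ (11 * r ^ 2) * (k : ℝ) ^ r * L ≤ Fintype.card V) (x : Finset V → ℝ) :
    0 ≤ ∑ I ∈ powersetCard r (univ : Finset V), ∑ J ∈ powersetCard r univ,
      x I * x J * (cliqueWeight r k #(I ∪ J) *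
        ((∏ a ∈ I \ J, ∏ b ∈ J \ I, adjInd G a b) * #(cliqueExtensions G #(I ∩ J) (I ∪ J)))) := by
  set n := Fintype.card V with hn
  set S := powersetCard r (univ : Finset V) with hS
  set X := ∑ I ∈ S, x I ^ 2 with hX
  set B : Finset V → Finset V → ℝ := fun I J => ∏ a ∈ I \ J, ∏ b ∈ J \ I, adjInd G a b with hB
  set w : ℕ → ℝ := fun i => cliqueWeight r k (2 * r - i) with hw
  set D : ℕ → ℝ := fun i => cliqueMainTerm n i (2 * r - i) with hD
  set d : Finset V → Finset V → ℝ := fun I J => #(cliqueExtensions G #(I ∩ J) (I ∪ J)) with hd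
  have hX0 : 0 ≤ X := sum_nonneg fun _ _ => sq_nonneg _
  have hk1 : 1 ≤ k := hr.trans hk
  have hn0 : 0 < n := lt_of_lt_of_le (by positivity) hgrow
  have hnR : (0 : ℝ) < n := by exact_mod_cast hn0
  have hcard : ∀ {I J : Finset V}, #I = r → #J = r → #(I ∪ J) = 2 * r - #(I ∩ J) := by
    intro I J hI hJ
    have := card_union_add_card_inter I J
    omega
  have hα : ∀ a b, |adjInd G a b| ≤ 1 := fun a b => by unfold adjInd; split_ifs <;> simp
  have hα0 : ∀ a, adjInd G a a = 0 := fun a => by simp [adjInd]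
  have hB1 : ∀ I J, |B I J| ≤ 1 := fun I J => by
    simp only [hB, abs_prod]
    exact prod_le_one (fun _ _ => prod_nonneg fun _ _ => abs_nonneg _) fun a _ =>
      prod_le_one (fun _ _ => abs_nonneg _) fun b _ => hα a b
  have hsplit : ∑ I ∈ S, ∑ J ∈ S, x I * x J * (cliqueWeight r k #(I ∪ J) * (B I J * d I J)) =
      ∑ I ∈ S, ∑ J ∈ S, x I * x J * mainEntry n r k #(I ∩ J) +
      (∑ i ∈ range (r + 1), w i * D i * ∑ I ∈ S, ∑ J ∈ S,
        (if #(I ∩ J) = i then x I * x J * (B I J - (1 / 2) ^ ((r - i) ^ 2)) else 0) +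
      ∑ i ∈ range (r + 1), w i * ∑ I ∈ S, ∑ J ∈ S,
        (if #(I ∩ J) = i then x I * x J * (B I J * (d I J - D i)) else 0)) := by
    have h2 : ∑ i ∈ range (r + 1), w i * D i * ∑ I ∈ S, ∑ J ∈ S,
        (if #(I ∩ J) = i then x I * x J * (B I J - (1 / 2) ^ ((r - i) ^ 2)) else 0) =
        ∑ I ∈ S, ∑ J ∈ S, w #(I ∩ J) * D #(I ∩ J) *
          (x I * x J * (B I J - (1 / 2) ^ ((r - #(I ∩ J)) ^ 2))) := by
      rw [sum_eq_sum_card_inter]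
      simp_rw [mul_sum]
      refine sum_congr rfl fun i _ => sum_congr rfl fun I _ => sum_congr rfl fun J _ => ?_
      split_ifs with h
      · rw [h]
      · simp
    have h3 : ∑ i ∈ range (r + 1), w i * ∑ I ∈ S, ∑ J ∈ S,
        (if #(I ∩ J) = i then x I * x J * (B I J * (d I J - D i)) else 0) =
        ∑ I ∈ S, ∑ J ∈ S, w #(I ∩ J) * (x I * x J * (B I J * (d I J - D #(I ∩ J)))) := by
      rw [sum_eq_sum_card_inter]
      simp_rw [mul_sum]
      refine sum_congr rfl fun i _ => sum_congr rfl fun I _ => sum_congr rfl fun J _ => ?_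
      split_ifs with h
      · rw [h]
      · simp
    rw [h2, h3]
    simp_rw [← sum_add_distrib]
    refine sum_congr rfl fun I hI => sum_congr rfl fun J hJ => ?_
    rw [hcard (mem_powersetCard.1 hI).2 (mem_powersetCard.1 hJ).2]
    simp only [hw, hD, mainEntry]
    ring
  have hmain := le_sum_mul_of_growth (mainEntry_nonneg n r k)
    (fun j hj => mainEntry_growth hgrow hj) x
  have hw0 : ∀ i, 0 ≤ w i := fun i => cliqueWeight_nonneg _ _ _
  have hwk : ∀ i, w i ≤ (k : ℝ) ^ (2 * r) := fun i => cliqueWeight_le hk1 (Nat.sub_le _ _)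
  -- both error terms for intersection size `i`
  have herr : ∀ i ∈ range (r + 1), n * |w i * D i * ∑ I ∈ S, ∑ J ∈ S,
        (if #(I ∩ J) = i then x I * x J * (B I J - (1 / 2) ^ ((r - i) ^ 2)) else 0)| +
      n * |w i * ∑ I ∈ S, ∑ J ∈ S,
        (if #(I ∩ J) = i then x I * x J * (B I J * (d I J - D i)) else 0)| ≤
      r.choose i * ((k : ℝ) ^ (2 * r) * r ^ 2 * n ^ r * L * X) := by
    intro i hi
    have hir : i ≤ r := Nat.lt_succ_iff.1 (mem_range.1 hi)
    obtain ⟨s, rfl⟩ := Nat.exists_eq_add_of_le hir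
    rw [Nat.add_sub_cancel_left]
    have h1 := abs_sum_card_inter_eq_le hL hW hα hα0 (rfl : i + s = i + s) x
    have hφ : ∀ I J : Finset V, #I = i + s → #J = i + s → #(I ∩ J) = i →
        |B I J * (d I J - D i)| ≤ i * n ^ i * L / n := by
      intro I J hI hJ hIJ
      rw [abs_mul, le_div_iff₀ hnR]
      have hc := hcard hI hJ
      have h := abs_card_cliqueExtensions_sub_le hN i (I ∪ J) (by omega)
      rw [hc, hIJ] at h
      have e : d I J = #(cliqueExtensions G i (I ∪ J)) := by simp only [hd, hIJ]
      rw [e]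
      calc _ ≤ 1 * |(#(cliqueExtensions G i (I ∪ J)) : ℝ) - D i| * n := by
            gcongr
            exact hB1 I J
        _ = n * |(#(cliqueExtensions G i (I ∪ J)) : ℝ) - D i| := by ring
        _ ≤ _ := h
    have h2 := abs_sum_card_inter_eq_le_of_abs_le hir (by positivity) hφ x
    rw [Nat.add_sub_cancel_left] at h2
    have hDi0 : 0 ≤ D i := cliqueMainTerm_nonneg _ _ _
    rw [abs_mul (w i * D i), abs_mul (w i), abs_mul (w i),
      abs_of_nonneg (hw0 i), abs_of_nonneg hDi0]
    have hDi : D i ≤ (n : ℝ) ^ i := cliqueMainTerm_le _ _ _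
    set c : ℝ := ((i + s).choose i : ℝ) with hc
    set K : ℝ := (k : ℝ) ^ (2 * (i + s)) with hK
    have b1 : n * (w i * D i * |∑ I ∈ S, ∑ J ∈ S,
        (if #(I ∩ J) = i then x I * x J * (B I J - (1 / 2) ^ (s ^ 2)) else 0)|) ≤
        K * n ^ i * (s ^ 2 * c * n ^ s * L * X) := by
      calc _ = w i * D i * (n * |∑ I ∈ S, ∑ J ∈ S,
            (if #(I ∩ J) = i then x I * x J * (B I J - (1 / 2) ^ (s ^ 2)) else 0)|) := by ring
        _ ≤ K * n ^ i * (s ^ 2 * c * n ^ s * L * X) := by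
            have := hwk i
            gcongr
    have b2 : n * (w i * |∑ I ∈ S, ∑ J ∈ S,
        (if #(I ∩ J) = i then x I * x J * (B I J * (d I J - D i)) else 0)|) ≤
        K * (i * n ^ i * L * (c * n ^ s) * X) := by
      calc _ = w i * (n * |∑ I ∈ S, ∑ J ∈ S,
            (if #(I ∩ J) = i then x I * x J * (B I J * (d I J - D i)) else 0)|) := by ring
        _ ≤ K * (n * (i * n ^ i * L / n * (c * n ^ s) * X)) := by
            have := hwk i
            gcongr
        _ = _ := by field_simp
    have hi2 : (s : ℝ) ^ 2 + i ≤ (i + s) ^ 2 := by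
      have : s ^ 2 + i ≤ (i + s) ^ 2 := by
        nlinarith [Nat.zero_le (i * s), Nat.le_self_pow two_ne_zero i]
      exact_mod_cast this
    push_cast
    calc _ ≤ K * n ^ i * (s ^ 2 * c * n ^ s * L * X) + K * (i * n ^ i * L * (c * n ^ s) * X) :=
          add_le_add b1 b2
      _ = c * (K * (s ^ 2 + i) * (n ^ i * n ^ s) * L * X) := by ring
      _ ≤ _ := by
          rw [← pow_add]
          gcongr
  set E1 := ∑ i ∈ range (r + 1), w i * D i * ∑ I ∈ S, ∑ J ∈ S,
        (if #(I ∩ J) = i then x I * x J * (B I J - (1 / 2) ^ ((r - i) ^ 2)) else 0) with hE1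
  set E2 := ∑ i ∈ range (r + 1), w i * ∑ I ∈ S, ∑ J ∈ S,
        (if #(I ∩ J) = i then x I * x J * (B I J * (d I J - D i)) else 0) with hE2
  have hE : n * (|E1| + |E2|) ≤ 2 ^ (3 * r) * ((k : ℝ) ^ (2 * r) * n ^ r * L * X) := by
    have h1 : n * (|E1| + |E2|) ≤ ∑ i ∈ range (r + 1),
        r.choose i * ((k : ℝ) ^ (2 * r) * r ^ 2 * n ^ r * L * X) := by
      refine le_trans ?_ (sum_le_sum herr)
      rw [sum_add_distrib, ← mul_sum, ← mul_sum, ← mul_add]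
      gcongr
      · exact abs_sum_le_sum_abs _ _
      · exact abs_sum_le_sum_abs _ _
    rw [← sum_mul, ← Nat.cast_sum, Nat.sum_range_choose] at h1
    refine h1.trans ?_
    have h2 : (r : ℝ) ≤ 2 ^ r := by exact_mod_cast (Nat.lt_two_pow_self (n := r)).le
    push_cast
    calc _ ≤ (2 : ℝ) ^ r * ((k : ℝ) ^ (2 * r) * (2 ^ r) ^ 2 * n ^ r * L * X) := by gcongr
      _ = _ := by rw [show 3 * r = r + r * 2 by ring, pow_add 2 r, pow_mul]; ring
  -- comparison of the error with the smallest eigenvalue of the main part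
  have hcmp : 2 ^ (3 * r) * ((k : ℝ) ^ (2 * r) * n ^ r * L * X) ≤
      n * ((1 / 2) ^ r * mainEntry n r k r * X) := by
    have h1 := le_mainEntry_self (n := n) hr hk
    have h2 : (2 : ℝ) ^ (3 * r) * 2 ^ r * 2 ^ (7 * r ^ 2) ≤ 2 ^ (11 * r ^ 2) := by
      rw [← pow_add, ← pow_add]
      exact pow_le_pow_right₀ (by norm_num) (by nlinarith)
    have h3 : (2 : ℝ) ^ (3 * r) * ((k : ℝ) ^ (2 * r) * n ^ r * L * X) * (2 ^ r * 2 ^ (7 * r ^ 2)) ≤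
        n * (k ^ r * n ^ r * X) := by
      calc _ = (2 : ℝ) ^ (3 * r) * 2 ^ r * 2 ^ (7 * r ^ 2) * (k ^ r * L) * (k ^ r * n ^ r * X) := by
            rw [two_mul r, pow_add (k : ℝ)]; ring
        _ ≤ 2 ^ (11 * r ^ 2) * (k ^ r * L) * (k ^ r * n ^ r * X) := by gcongr
        _ ≤ _ := by
            rw [← mul_assoc (2 ^ _) (_ ^ _) L]
            gcongr
    have h4 : n * (k ^ r * n ^ r * X) ≤
        n * ((1 / 2) ^ r * mainEntry n r k r * X) * (2 ^ r * 2 ^ (7 * r ^ 2)) := by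
      calc _ ≤ n * (2 ^ (7 * r ^ 2) * mainEntry n r k r * X) := by gcongr
        _ = n * (((1 / 2 : ℝ) * 2) ^ r * mainEntry n r k r * X) * 2 ^ (7 * r ^ 2) := by
            norm_num; ring
        _ = _ := by rw [mul_pow]; ring
    exact le_of_mul_le_mul_right (h3.trans h4) (by positivity)
  have hfin : |E1| + |E2| ≤ (1 / 2) ^ r * mainEntry n r k r * X :=
    le_of_mul_le_mul_left (hE.trans hcmp) hnR
  rw [hsplit]
  linarith [neg_abs_le E1, neg_abs_le E2]

end QuadraticForm

/-! ### The matrix of clique degrees -/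

theorem cliqueMatrix_apply {n : ℕ} (G : SimpleGraph (Fin n)) (r k : ℕ)
    (I J : {I : Finset (Fin n) // #I = r}) :
    cliqueMatrix G r k I J = cliqueDeg G r (I.1 ∪ J.1) * cliqueWeight r k #(I.1 ∪ J.1) := rfl

theorem cliqueMatrix_isHermitian {n : ℕ} (G : SimpleGraph (Fin n)) (r k : ℕ) :
    (cliqueMatrix G r k).IsHermitian := by
  ext I J
  simp only [Matrix.conjTranspose_apply, star_trivial, cliqueMatrix_apply, union_comm]

theorem cliqueMatrix_eq_zero {n : ℕ} (G : SimpleGraph (Fin n)) {r k : ℕ} (hk : k < r) :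
    cliqueMatrix G r k = 0 := by
  ext I J
  have : r ≤ #(I.1 ∪ J.1) := by
    have h := card_le_card (subset_union_left : I.1 ⊆ I.1 ∪ J.1)
    have := I.2
    omega
  rw [cliqueMatrix_apply, cliqueWeight, Nat.choose_eq_zero_of_lt (hk.trans_le this)]
  simp

/-- Rows and columns of non-cliques vanish, so that they may be masked in the vector. -/
theorem cliqueMatrix_posSemidef {n r k : ℕ} {G : SimpleGraph (Fin n)}
    (h : ∀ x : Finset (Fin n) → ℝ,
      0 ≤ ∑ I ∈ powersetCard r (univ : Finset (Fin n)), ∑ J ∈ powersetCard r univ,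
        x I * x J * (cliqueWeight r k #(I ∪ J) * ((∏ a ∈ I \ J, ∏ b ∈ J \ I, adjInd G a b) *
          #(cliqueExtensions G #(I ∩ J) (I ∪ J))))) :
    (cliqueMatrix G r k).PosSemidef := by
  classical
  refine .of_dotProduct_mulVec_nonneg (cliqueMatrix_isHermitian G r k) fun x => ?_
  set y : Finset (Fin n) → ℝ := fun I =>
    if hI : #I = r then (if G.IsClique (I : Set (Fin n)) then x ⟨I, hI⟩ else 0) else 0 with hy
  have hsum : ∀ f : Finset (Fin n) → ℝ, ∑ I ∈ powersetCard r (univ : Finset (Fin n)), f I =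
      ∑ I : {I : Finset (Fin n) // #I = r}, f I := fun f =>
    sum_subtype _ (fun I => by simp [mem_powersetCard]) f
  have hyx := h y
  rw [hsum] at hyx
  simp_rw [hsum] at hyx
  refine hyx.trans_eq ?_
  simp only [dotProduct, Matrix.mulVec, star_trivial, mul_sum]
  refine sum_congr rfl fun I _ => sum_congr rfl fun J _ => ?_
  rw [cliqueMatrix_apply, cliqueDeg_union G I.2 J.2]
  simp only [hy, I.2, J.2, dite_true, Subtype.coe_eta]
  split_ifs <;> ring

theorem theorem2p3 :
    ∃ c : ℝ, 0 < c ∧ ∀ ε : ℝ, 0 < ε → ∃ N : ℕ, ∀ n r : ℕ, N ≤ n → 1 ≤ r →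
      1 - ε ≤ (randomGraphHalf n).real
        {G : SimpleGraph (Fin n) | ∀ k : ℕ,
          (k : ℝ) ≤ (2 : ℝ) ^ (-(c * (r : ℝ))) *
            (Real.sqrt (n : ℝ) / Real.log (n : ℝ)) ^ (1 / (r : ℝ)) →
          (cliqueMatrix G r k).PosSemidef} := by
  -- `18 = 11 + 7`: the exponent `11 * r ^ 2` of `cliqueForm_nonneg` and the constant `2 ^ 7` in `L`
  refine ⟨18, by norm_num, fun ε hε => ?_⟩
  obtain ⟨N, hN⟩ : ∃ N : ℕ, ∀ n : ℕ, N ≤ n →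
      2 * Real.exp (-n) + 2 / (n : ℝ) ≤ ε ∧ 1 ≤ Real.log n := by
    have h1 : Filter.Tendsto (fun n : ℕ => 2 * Real.exp (-(n : ℝ)) + 2 / (n : ℝ)) Filter.atTop
        (nhds (2 * 0 + 0)) :=
      ((Real.tendsto_exp_neg_atTop_nhds_zero.comp tendsto_natCast_atTop_atTop).const_mul 2).add
        (tendsto_const_div_atTop_nhds_zero_nat 2)
    have h2 := Real.tendsto_log_atTop.comp (tendsto_natCast_atTop_atTop (R := ℝ))
    exact Filter.eventually_atTop.1 ((h1.eventually_le_const (by simpa using hε)).and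
      (h2.eventually_ge_atTop 1))
  refine ⟨N, fun n r hn hr => ?_⟩
  obtain ⟨hε', hlog⟩ := hN n hn
  have hn0 : 0 < n := Nat.pos_of_ne_zero fun h => by rw [h] at hlog; norm_num at hlog
  have hnR : (0 : ℝ) < n := by exact_mod_cast hn0
  -- the hypothesis on `k`, raised to the power `r`
  have hpow : ∀ k : ℕ, (k : ℝ) ≤ (2 : ℝ) ^ (-(18 * (r : ℝ))) *
      (√(n : ℝ) / Real.log n) ^ (1 / (r : ℝ)) →
      2 ^ (18 * r ^ 2) * (k : ℝ) ^ r * Real.log n ≤ √n := by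
    intro k hk
    have hr0 : (r : ℝ) ≠ 0 := by positivity
    have h1 := pow_le_pow_left₀ (Nat.cast_nonneg k) hk r
    rw [mul_pow, ← Real.rpow_natCast ((2 : ℝ) ^ _), ← Real.rpow_natCast ((√_ / _) ^ _),
      ← Real.rpow_mul (by norm_num), ← Real.rpow_mul (by positivity), one_div_mul_cancel hr0,
      Real.rpow_one, show -(18 * (r : ℝ)) * r = -((18 * r ^ 2 : ℕ) : ℝ) by push_cast; ring,
      Real.rpow_neg (by norm_num), Real.rpow_natCast] at h1
    calc _ ≤ 2 ^ (18 * r ^ 2) * ((2 ^ (18 * r ^ 2))⁻¹ * (√(n : ℝ) / Real.log n)) *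
          Real.log n := by gcongr
      _ = √n := by field_simp
  by_cases hex : ∃ k : ℕ, r ≤ k ∧ (k : ℝ) ≤ (2 : ℝ) ^ (-(18 * (r : ℝ))) *
      (√(n : ℝ) / Real.log n) ^ (1 / (r : ℝ))
  swap
  · -- only `k < r` is allowed, and then the matrix vanishes for every graph
    have : {G : SimpleGraph (Fin n) | ∀ k : ℕ, (k : ℝ) ≤ (2 : ℝ) ^ (-(18 * (r : ℝ))) *
        (√(n : ℝ) / Real.log n) ^ (1 / (r : ℝ)) → (cliqueMatrix G r k).PosSemidef} = Set.univ := by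
      refine Set.eq_univ_of_forall fun G k hk => ?_
      have : k < r := not_le.1 fun h => hex ⟨k, h, hk⟩
      rw [cliqueMatrix_eq_zero G this]
      exact Matrix.PosSemidef.zero
    rw [this, probReal_univ]
    linarith
  have hrlog : 2 * (r : ℝ) ≤ Real.log n := by
    obtain ⟨k, hrk, hk⟩ := hex
    have h1 := hpow k hk
    have hk1 : (1 : ℝ) ≤ (k : ℝ) ^ r := one_le_pow₀ (by exact_mod_cast hr.trans hrk)
    have h2 : (2 : ℝ) ^ (18 * r ^ 2) ≤ √n := by
      refine le_trans ?_ h1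
      rw [mul_assoc]
      exact le_mul_of_one_le_right (by positivity) (one_le_mul_of_one_le_of_one_le hk1 hlog)
    have h3 := Real.log_le_log (by positivity) h2
    rw [Real.log_pow, Real.log_sqrt hnR.le] at h3
    push_cast at h3
    have h4 := Real.log_two_gt_d9
    have h5 : (1 : ℝ) ≤ r := by exact_mod_cast hr
    nlinarith
  refine le_trans ?_ ((randomGraphHalf_pseudorandom hlog hr hrlog).trans
    (measureReal_mono (Set.ofPred_subset_ofPred.2 fun G hG k hk => ?_)))
  · linarith
  rcases lt_or_ge k r with hkr | hkr
  · rw [cliqueMatrix_eq_zero G hkr]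
    exact Matrix.PosSemidef.zero
  obtain ⟨hdisc, hsplit⟩ := hG
  set ℓ := Real.log n with hℓ
  have hk := hpow k hk
  have hsqrt1 : (1 : ℝ) ≤ √n := by
    rw [Real.one_le_sqrt]; exact_mod_cast hn0
  set L : ℝ := 2 ^ 7 * √n * ℓ with hL
  have hL0 : 0 ≤ L := by positivity
  have hnl : 1 ≤ √n * ℓ := one_le_mul_of_one_le_of_one_le hsqrt1 hlog
  have hW : BilinBound (fun a b => adjInd G a b - if a = b then 0 else 1 / 2) L := by
    have hb := bilinBound_adjInd_sub (by positivity) hdisc (l := Nat.clog 2 n)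
      (by rw [Fintype.card_fin]; exact Nat.le_pow_clog (by norm_num) n)
    rw [Fintype.card_fin] at hb
    have hclog : (Nat.clog 2 n : ℝ) ≤ 3 * ℓ := by
      have h1 : 1 < n := by
        rcases Nat.lt_or_ge 1 n with h | h
        · exact h
        · obtain rfl : n = 1 := by omega
          norm_num [hℓ] at hlog
      have h2 := Nat.pow_pred_clog_lt_self (b := 2) (by norm_num) h1
      have h3 : (2 : ℝ) ^ (Nat.clog 2 n).pred ≤ n := by exact_mod_cast h2.le
      have h4 := Real.log_le_log (by positivity) h3
      rw [Real.log_pow] at h4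
      have h5 : (Nat.clog 2 n : ℝ) ≤ (Nat.clog 2 n).pred + 1 := by
        have : Nat.clog 2 n ≤ (Nat.clog 2 n).pred + 1 := by rw [Nat.pred_eq_sub_one]; omega
        exact_mod_cast this
      have h6 := Real.log_two_gt_d9
      have h7 : (0 : ℝ) ≤ (Nat.clog 2 n).pred := Nat.cast_nonneg _
      nlinarith
    intro x y
    refine (hb x y).trans ?_
    gcongr
    have : √n * (Nat.clog 2 n : ℝ) ≤ √n * (3 * ℓ) := by gcongr
    have : √n ≤ √n * ℓ := le_mul_of_one_le_right (by positivity) hlog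
    rw [hL]
    nlinarith
  refine cliqueMatrix_posSemidef (cliqueForm_nonneg hr hkr hL0 hW ?_ ?_ ?_)
  · intro U hU
    refine (abs_card_commonNbrs_sub_le (by positivity) hsplit U hU).trans ?_
    rw [hL]
    nlinarith
  · rw [Fintype.card_fin]
    have h1 : (2 : ℝ) ^ (2 * r) * k ≤ 2 ^ (18 * r ^ 2) * (k : ℝ) ^ r * ℓ := by
      have h2 : (2 : ℝ) ^ (2 * r) ≤ 2 ^ (18 * r ^ 2) :=
        pow_le_pow_right₀ (by norm_num) (by nlinarith)
      have h3 : (k : ℝ) ≤ (k : ℝ) ^ r :=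
        le_self_pow₀ (by exact_mod_cast hr.trans hkr) (by omega)
      calc _ ≤ (2 : ℝ) ^ (18 * r ^ 2) * (k : ℝ) ^ r := by gcongr
        _ ≤ _ := le_mul_of_one_le_right (by positivity) hlog
    have h2 : √(n : ℝ) ≤ n := by
      calc √(n : ℝ) ≤ √n * √n := le_mul_of_one_le_right (by positivity) hsqrt1
        _ = n := Real.mul_self_sqrt hnR.le
    exact_mod_cast h1.trans (hk.trans h2)
  · rw [Fintype.card_fin]
    calc _ = (2 : ℝ) ^ (11 * r ^ 2 + 7) * (k : ℝ) ^ r * ℓ * √n := by rw [hL, pow_add]; ring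
      _ ≤ 2 ^ (18 * r ^ 2) * (k : ℝ) ^ r * ℓ * √n := by
          have : (2 : ℝ) ^ (11 * r ^ 2 + 7) ≤ 2 ^ (18 * r ^ 2) :=
            pow_le_pow_right₀ (by norm_num) (by nlinarith)
          gcongr
      _ ≤ √n * √n := by gcongr
      _ = n := Real.mul_self_sqrt hnR.le
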